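/- **Conventions.** A $k$-graph $H$ on a finite vertex set $V$ is identified with its set of edges, which are $k$-element subsets of $V$; every $2$-edge-colouring uses the colours red and blue, and $H^{\mathrm{red}}$, $H^{\mathrm{blue}}$ denote the subgraphs of red and of blue edges. For $S\subseteq V$ with $|S|\le k$ let $d_H(S)$ be the number of $(k-|S|)$-sets $T \subseteq V$ with $T\cup S\in H$. A $k$-graph $H$ on $n$ vertices is *$(\mu,\alpha)$-dense* if for each $1\le i\le k-1$ we have $d_H(S)\ge\mu\binom{n}{k-i}$ for all but at most $\alpha\binom ni$ of the $i$-sets $S\subseteq V$, and $d_H(S)=0$ for all other $i$-sets $S$. A set $F$ of edges of $H$ is *tightly connected in $H$* if any two edges $f,f'\in F$ are joined by a sequence of edges $f=e_1,\dots,e_t=f'$ of $H$ with $|e_j\cap e_{j+1}|=k-1$ for all $1\le j<t$ (the empty set is tightly connected); a *tight component* of $H$ is a maximal tightly connected set of edges. A *matching* is a (possibly empty) set of pairwise disjoint edges. A *red (blue) tight component*, respectively *tightly connected matching*, of a $2$-edge-coloured $H$ is one in $H^{\mathrm{red}}$ ($H^{\mathrm{blue}}$). A *fractional matching* of $H$ is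 a function $\omega:H\to[0,1]$ with $\sum_{e\ni v}\omega(e)\le1$ for every vertex $v$; its *weight* is $\sum_{e\in H}\omega(e)$. For $\beta,\varepsilon>0$ let $\mu_k^*(\beta,\varepsilon,n)$ be the largest (supremum of all) $\mu$ such that every $2$-edge-coloured $(1-\varepsilon,\varepsilon)$-dense $k$-graph on $n$ vertices contains a fractional matching with weight $\mu$ such that all edges of non-zero weight have weight at least $\beta$ and lie in the union of one red and one blue tight component, and let $\mu_k^*(\beta)=\liminf_{\varepsilon\to0^+}\liminf_{n\to\infty}\mu_k^*(\beta,\varepsilon,n)/n$. **Lemma 6.1.** There are non-decreasing functions $f,g,h:(0,1]\to(0,1]$ such that the following holds for every positive integer $n$ and all $\varepsilon,\alpha\in(0,1]$ and $\eta\in(0,1)$ with $1/n\le f(\varepsilon)$, $\varepsilon\le g(\alpha)$ and $\alpha\le h(\eta)$ (that is, for $1/n\ll\varepsilon\ll\alpha\ll\eta<1$). Every $2$-edge-coloured $(1-\varepsilon,\alpha)$-dense $4$-graph $H$ on $n$ vertices contains a red tightly connected matching and a blue tightly connected matching that are vertex-disjoint and that together cover all but at most $3\eta n$ of the vertices of $H$.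 Moreover, $\mu_4^*(1)\ge 1/4$. -/

import Mathlib

open Finset Filter Topology

/-- The two colours used in every 2-edge-colouring. -/
inductive EdgeColour where
  | red
  | blue
  deriving DecidableEq

/-- A `k`-graph with vertex set `V`: a set of edges, all of which are `k`-element subsets of `V`. -/
structure KGraph (V : Type*) (k : ℕ) where
  edges : Finset (Finset V)
  uniform : ∀ e ∈ edges, e.card = k

namespace KGraph

/-- `N_H(S)`: the `(k - |S|)`-sets `T` of vertices such that `T ∪ S` is an edge of `H`. -/
def nbhd {V : Type*} [Fintype V] [DecidableEq V] {k : ℕ} (H : KGraph V k) (S : Finset V) :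
    Finset (Finset V) :=
  (powersetCard (k - S.card) univ).filter (fun T => T ∪ S ∈ H.edges)

/-- `d_H(S) = |N_H(S)|`. -/
def degree {V : Type*} [Fintype V] [DecidableEq V] {k : ℕ} (H : KGraph V k) (S : Finset V) :
    ℕ := (H.nbhd S).card

/-- `H` is `(μ, α)`-dense: for each `1 ≤ i ≤ k - 1` there is a family `X` of at most
`α * (n choose i)` `i`-sets of degree zero, and every `i`-set outside `X` has degree at least
`μ * (n choose (k - i))`, where `n` is the number of vertices. -/
def IsDense {V : Type*} [Fintype V] [DecidableEq V] {k : ℕ} (H : KGraph V k) (μ α : ℝ) : Prop :=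
  ∀ i : ℕ, 1 ≤ i → i ≤ k - 1 →
    ∃ X ⊆ powersetCard i (univ : Finset V),
      (X.card : ℝ) ≤ α * ((Fintype.card V).choose i : ℝ) ∧
      (∀ S ∈ powersetCard i (univ : Finset V), S ∉ X →
        μ * ((Fintype.card V).choose (k - i) : ℝ) ≤ (H.degree S : ℝ)) ∧
      (∀ S ∈ X, H.degree S = 0)

/-- The subgraph of `H` (with the same vertices) formed by the edges of colour `i`. The value of
the colouring `c` on sets that are not edges of `H` plays no role. -/
def colourClass {V : Type*} {k : ℕ} (H : KGraph V k) (c : Finset V → EdgeColour)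
    (i : EdgeColour) : KGraph V k where
  edges := H.edges.filter (fun e => c e = i)
  uniform := fun e he => H.uniform e (mem_filter.mp he).1

/-- Two edges of `H` that share exactly `k - 1` vertices. -/
def TightAdj {V : Type*} [DecidableEq V] {k : ℕ} (H : KGraph V k) (e e' : Finset V) : Prop :=
  e ∈ H.edges ∧ e' ∈ H.edges ∧ (e ∩ e').card = k - 1

/-- A set `F` of edges of `H` is tightly connected in `H` if any two edges `f, f'` of `F` are joined
by a sequence of edges of `H` (not necessarily of `F`) from `f` to `f'` in which consecutive edges
share exactly `k - 1` vertices. The empty set of edges is tightly connected. -/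
def IsTightlyConnected {V : Type*} [DecidableEq V] {k : ℕ} (H : KGraph V k)
    (F : Finset (Finset V)) : Prop :=
  F ⊆ H.edges ∧ ∀ f ∈ F, ∀ f' ∈ F, Relation.ReflTransGen H.TightAdj f f'

/-- A tight component of `H`: a maximal tightly connected set of edges. In a `k`-graph without
edges, the empty set is the only tight component. -/
def IsTightComponent {V : Type*} [DecidableEq V] {k : ℕ} (H : KGraph V k)
    (C : Finset (Finset V)) : Prop :=
  Maximal H.IsTightlyConnected C

/-- A matching in `H`: a (possibly empty) set of pairwise disjoint edges. -/
def IsMatching {V : Type*} {k : ℕ} (H : KGraph V k) (M : Finset (Finset V)) : Prop :=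
  M ⊆ H.edges ∧ ∀ e ∈ M, ∀ e' ∈ M, e ≠ e' → Disjoint e e'

/-- A tightly connected matching in `H`. -/
def IsTightlyConnectedMatching {V : Type*} [DecidableEq V] {k : ℕ} (H : KGraph V k)
    (M : Finset (Finset V)) : Prop :=
  H.IsMatching M ∧ H.IsTightlyConnected M

/-- A fractional matching of `H`: weights in `[0, 1]` on the edges, of total at most `1` at every
vertex. Values of `ω` on sets that are not edges of `H` play no role. -/
def IsFractionalMatching {V : Type*} [DecidableEq V] {k : ℕ} (H : KGraph V k)
    (ω : Finset V → ℝ) : Prop :=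
  (∀ e ∈ H.edges, 0 ≤ ω e ∧ ω e ≤ 1) ∧ ∀ v : V, ∑ e ∈ H.edges with v ∈ e, ω e ≤ 1

/-- The weight of a fractional matching of `H`. -/
def weight {V : Type*} {k : ℕ} (H : KGraph V k) (ω : Finset V → ℝ) : ℝ := ∑ e ∈ H.edges, ω e

end KGraph

/-- The set of vertices covered by a set of edges. -/
def coveredVertices {V : Type*} [DecidableEq V] (M : Finset (Finset V)) : Finset V := M.biUnion id

/-- `m` is such that every 2-edge-coloured `(1 - ε, ε)`-dense `k`-graph on `n` vertices contains a
fractional matching of weight `m` all of whose edges of non-zero weight have weight at least `β` and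
lie in one red and one blue tight component. -/
def IsForcedWeight (k : ℕ) (β ε : ℝ) (n : ℕ) (m : ℝ) : Prop :=
  ∀ (H : KGraph (Fin n) k) (c : Finset (Fin n) → EdgeColour), H.IsDense (1 - ε) ε →
    ∃ ω : Finset (Fin n) → ℝ, H.IsFractionalMatching ω ∧ H.weight ω = m ∧
      (∀ e ∈ H.edges, ω e ≠ 0 → β ≤ ω e) ∧
      ∃ R B : Finset (Finset (Fin n)),
        (H.colourClass c .red).IsTightComponent R ∧
        (H.colourClass c .blue).IsTightComponent B ∧
        ∀ e ∈ H.edges, ω e ≠ 0 → e ∈ R ∨ e ∈ B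

/-- `μ_k^*(β, ε, n)`: the largest forced weight, taken as a supremum in the extended reals (for fixed
`ε > 0` it is finite for all large `n`, because the complete `k`-graph is then dense). -/
noncomputable def muStarFinite (k : ℕ) (β ε : ℝ) (n : ℕ) : EReal :=
  sSup ((fun m : ℝ => (m : EReal)) '' {m : ℝ | IsForcedWeight k β ε n m})

/-- `μ_k^*(β) = liminf_{ε → 0} liminf_{n → ∞} μ_k^*(β, ε, n) / n`, with `ε > 0`. -/
noncomputable def muStar (k : ℕ) (β : ℝ) : EReal :=
  liminf (fun ε : ℝ =>
    liminf (fun n : ℕ => muStarFinite k β ε n / ((n : ℝ) : EReal)) atTop) (𝓝[>] (0 : ℝ))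

/-- The functions that are allowed in a hierarchy `a ≪ b`, which means `a ≤ f b`: non-decreasing
functions from `(0, 1]` to `(0, 1]`. -/
def IsHierarchyFunction (f : ℝ → ℝ) : Prop :=
  Set.MapsTo f (Set.Ioc 0 1) (Set.Ioc 0 1) ∧ MonotoneOn f (Set.Ioc 0 1)

/-! For almost every vertex added to an edge-contained pair, some colour and some tight component of
that colour contain an edge through the resulting triple; this gives the pair itself a colour and a
label. Two facts drive everything. A `4`-set with the colour of one of its pairs has that pair's
label, and adjacent pairs of the same colour have the same label. `CliqueSystem` abstracts exactly
this on a family of cliques in which almost every vertex extends every clique, and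
`exists_cliqueSystem` extracts such a system from a dense `4`-graph.

Inside a clique system, two disjoint red pairs with different labels force all blue pairs of their
common link to share a label. So after passing to a link, and exchanging colours if necessary, all
red pairs have one label `R` (`exists_link_pcomp_eq`). A maximal matching of red `R`-edges, enlarged
if needed by blue edges of one label `B`, leaves a set in which most pairs are blue with label `B`
(`hasCover_or_exists_matching`).

Take a matching of `R`-red and `B`-blue edges minimising a potential that counts bad leftover pairs,
red edges and uncovered vertices. The leftover has no edge of either label, so every `4`-clique in
it with a blue `B`-pair is red with a label other than `R`. A red edge of the matching could be
exchanged for blue edges, losing at most one of its vertices, which would lower the potential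
(`exists_replacement`). Hence the matching is entirely blue, the red label is free, and red edges
with the label seen in the leftover cover nearly all of it (`hasCover_of_forall_blueEdge`). This is
`hasCover`, from which the two matchings follow.

The bound on `muStar` follows by giving weight `1` to the edges of these matchings and letting the
uncovered proportion tend to zero. -/

/-! ### Clique systems, their links and their elementary rules -/

/-- A family of cliques in which all `4`-sets and pairs carry a colour (`True` is red) and a label,
such that labels of the same colour agree along tight adjacency. -/
structure CliqueSystem (V Λ : Type*) [DecidableEq V] where
  IsClique : Finset V → Prop
  col : Finset V → Prop
  pcol : Finset V → Prop
  comp : Finset V → Λ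
  pcomp : Finset V → Λ
  mono : ∀ {A B : Finset V}, A ⊆ B → IsClique B → IsClique A
  comp_eq_pcomp : ∀ {X p : Finset V}, IsClique X → #X = 4 → p ⊆ X → #p = 2 →
    (col X ↔ pcol p) → comp X = pcomp p
  comp_eq_comp : ∀ {X Y : Finset V}, IsClique X → IsClique Y → #X = 4 → #Y = 4 → #(X ∩ Y) = 3 →
    (col X ↔ col Y) → comp X = comp Y
  pcomp_eq_pcomp : ∀ {a b c : V}, a ≠ b → a ≠ c → b ≠ c → IsClique {a, b, c} →
    (pcol {a, b} ↔ pcol {a, c}) → pcomp {a, b} = pcomp {a, c}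

/-- There is an edge-maximal matching among the sets `e ⊆ U` with `E e`. -/
theorem exists_maximal_matching {V : Type*} [Fintype V] [DecidableEq V] (E : Finset V → Prop)
    (hE : ∀ e, E e → e.Nonempty) (U : Finset V) :
    ∃ M : Finset (Finset V), (∀ e ∈ M, E e ∧ e ⊆ U) ∧ (M : Set (Finset V)).PairwiseDisjoint id ∧
      ∀ e, E e → e ⊆ U \ coveredVertices M → False := by
  classical
  let F : Finset (Finset (Finset V)) := univ.filter fun M =>
    (∀ e ∈ M, E e ∧ e ⊆ U) ∧ (M : Set (Finset V)).PairwiseDisjoint id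
  have hF : F.Nonempty := ⟨∅, by simp [F]⟩
  obtain ⟨M, hM, hmax⟩ := F.exists_max_image card hF
  simp only [F, mem_filter, mem_univ, true_and] at hM hmax
  refine ⟨M, hM.1, hM.2, fun e he heU => ?_⟩
  have hdis : ∀ f ∈ M, Disjoint e f := by
    intro f hf
    refine Finset.disjoint_left.2 fun x hx hxf => ?_
    have := heU hx
    simp only [coveredVertices, Finset.mem_sdiff, mem_biUnion, id, not_exists, not_and] at this
    exact this.2 f hf hxf
  have heM : e ∉ M := by
    intro h
    obtain ⟨x, hx⟩ := hE e he
    exact Finset.disjoint_left.1 (hdis e h) hx hx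
  have := hmax (insert e M) ⟨?_, ?_⟩
  · rw [card_insert_of_notMem heM] at this
    omega
  · intro f hf
    rcases mem_insert.1 hf with rfl | hf
    · exact ⟨he, heU.trans sdiff_subset⟩
    · exact hM.1 f hf
  · rw [coe_insert]
    refine (Set.pairwiseDisjoint_insert).2 ⟨hM.2, fun f hf _ => hdis f hf⟩

theorem card_coveredVertices {V : Type*} [DecidableEq V] {M : Finset (Finset V)} {k : ℕ}
    (hM : (M : Set (Finset V)).PairwiseDisjoint id) (hk : ∀ e ∈ M, #e = k) :
    #(coveredVertices M) = #M * k := by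
  rw [coveredVertices, card_biUnion hM]
  exact sum_const_nat hk

theorem card_insert_insert_pair {V : Type*} [DecidableEq V] {a b c d : V} (hab : a ≠ b)
    (hac : a ≠ c) (had : a ≠ d) (hbc : b ≠ c) (hbd : b ≠ d) (hcd : c ≠ d) :
    #({a, b, c, d} : Finset V) = 4 := by
  rw [card_insert_of_notMem, card_insert_of_notMem, card_pair hcd] <;> simp [*]

theorem insert_triple_rotate {V : Type*} [DecidableEq V] (a b c d : V) :
    insert d ({a, b, c} : Finset V) = {a, b, c, d} := by
  ext v
  simp only [mem_insert, mem_singleton]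
  tauto

namespace CliqueSystem

section
variable {V Λ : Type*} [DecidableEq V] (S : CliqueSystem V Λ)

/-- All but `2 ^ #A * b` vertices extend a clique `A`. -/
def Extends [Fintype V] (b : ℝ) : Prop :=
  S.IsClique ∅ ∧ ∀ (A N : Finset V), S.IsClique A → (∀ w ∈ N, ¬ S.IsClique (insert w A)) →
    (#N : ℝ) ≤ 2 ^ #A * b

def RedEdge (R : Λ) (X : Finset V) : Prop := #X = 4 ∧ S.IsClique X ∧ S.col X ∧ S.comp X = R

def BlueEdge (B : Λ) (X : Finset V) : Prop := #X = 4 ∧ S.IsClique X ∧ ¬ S.col X ∧ S.comp X = B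

def BluePair (B : Λ) (a b : V) : Prop :=
  a ≠ b ∧ S.IsClique {a, b} ∧ ¬ S.pcol {a, b} ∧ S.pcomp {a, b} = B

/-- Some matching of edges of one red and one blue label misses at most `m` vertices. -/
def HasCover [Fintype V] (m : ℝ) : Prop :=
  ∃ (M : Finset (Finset V)) (R B : Λ), (M : Set (Finset V)).PairwiseDisjoint id ∧
    (∀ e ∈ M, S.RedEdge R e ∨ S.BlueEdge B e) ∧ (#(coveredVertices M)ᶜ : ℝ) ≤ m

/-- Exchange the two colours. -/
def swap : CliqueSystem V Λ where
  IsClique := S.IsClique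
  col X := ¬ S.col X
  pcol X := ¬ S.pcol X
  comp := S.comp
  pcomp := S.pcomp
  mono := S.mono
  comp_eq_pcomp h1 h2 h3 h4 h5 := S.comp_eq_pcomp h1 h2 h3 h4 (not_iff_not.1 h5)
  comp_eq_comp h1 h2 h3 h4 h5 h6 := S.comp_eq_comp h1 h2 h3 h4 h5 (not_iff_not.1 h6)
  pcomp_eq_pcomp h1 h2 h3 h4 h5 := S.pcomp_eq_pcomp h1 h2 h3 h4 (not_iff_not.1 h5)

/-- The cliques disjoint from `q` that form a clique with `q`. -/
def link (q : Finset V) : CliqueSystem V Λ where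
  IsClique A := Disjoint A q ∧ S.IsClique (A ∪ q)
  col := S.col
  pcol := S.pcol
  comp := S.comp
  pcomp := S.pcomp
  mono h h' := ⟨h'.1.mono_left h, S.mono (union_subset_union_left h) h'.2⟩
  comp_eq_pcomp h1 h2 h3 h4 h5 := S.comp_eq_pcomp (S.mono subset_union_left h1.2) h2 h3 h4 h5
  comp_eq_comp h1 h1' h2 h3 h4 h5 := S.comp_eq_comp (S.mono subset_union_left h1.2)
    (S.mono subset_union_left h1'.2) h2 h3 h4 h5
  pcomp_eq_pcomp h1 h2 h3 h4 h5 := S.pcomp_eq_pcomp h1 h2 h3 (S.mono subset_union_left h4.2) h5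

variable {S}

theorem HasCover.of_swap [Fintype V] {m : ℝ} (h : S.swap.HasCover m) : S.HasCover m := by
  obtain ⟨M, R, B, h1, h2, h3⟩ := h
  refine ⟨M, B, R, h1, fun e he => ?_, h3⟩
  rcases h2 e he with h | h
  · exact Or.inr h
  · exact Or.inl ⟨h.1, h.2.1, not_not.1 h.2.2.1, h.2.2.2⟩

theorem HasCover.of_link [Fintype V] {q : Finset V} {m : ℝ} (h : (S.link q).HasCover m) :
    S.HasCover m := by
  obtain ⟨M, R, B, h1, h2, h3⟩ := h
  refine ⟨M, R, B, h1, fun e he => ?_, h3⟩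
  rcases h2 e he with h | h
  · exact Or.inl ⟨h.1, S.mono subset_union_left h.2.1.2, h.2.2⟩
  · exact Or.inr ⟨h.1, S.mono subset_union_left h.2.1.2, h.2.2⟩

theorem Extends.swap [Fintype V] {b : ℝ} (h : S.Extends b) : S.swap.Extends b := h

/-- A vertex outside `q` that fails in the link fails to extend `A ∪ q`. The vertices of `q` itself
are at most `2 ^ #q` further exceptions, absorbed by one extra factor of two. -/
theorem Extends.link [Fintype V] {b : ℝ} (h : S.Extends b) (hb : 1 ≤ b) {q : Finset V}
    (hq : S.IsClique q) : (S.link q).Extends (2 ^ (#q + 1) * b) := by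
  refine ⟨⟨disjoint_empty_left _, by simpa using hq⟩, fun A N hA hN => ?_⟩
  have hA2 : S.IsClique (A ∪ q) := hA.2
  have key := h.2 (A ∪ q) (N \ q) hA2 ?_
  · rw [card_union_of_disjoint hA.1] at key
    have h1 : #N ≤ #(N \ q) + #q := by
      have := card_le_card_sdiff_add_card (s := N) (t := q)
      omega
    have h2 : (#N : ℝ) ≤ #(N \ q) + #q := by exact_mod_cast h1
    have h3 : (#q : ℝ) ≤ 2 ^ #q := by exact_mod_cast Nat.lt_two_pow_self.le
    have h4 : (1 : ℝ) ≤ 2 ^ #A := one_le_pow₀ (by norm_num)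
    have h5 : (0 : ℝ) < 2 ^ #q := by positivity
    have h6 : (2 : ℝ) ^ #q ≤ 2 ^ #A * 2 ^ #q * b := by
      calc (2 : ℝ) ^ #q = 1 * 2 ^ #q * 1 := by ring
        _ ≤ _ := by gcongr
    calc (#N : ℝ) ≤ 2 ^ (#A + #q) * b + 2 ^ #A * 2 ^ #q * b := by linarith
      _ = _ := by ring
  · intro w hw hc
    rw [Finset.mem_sdiff] at hw
    refine hN w hw.1 ⟨?_, ?_⟩
    · rw [disjoint_insert_left]
      exact ⟨hw.2, hA.1⟩
    · rwa [insert_union]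

theorem BluePair.symm {B : Λ} {a b : V} (h : S.BluePair B a b) : S.BluePair B b a := by
  obtain ⟨h1, h2, h3⟩ := h
  rw [pair_comm] at h2 h3
  exact ⟨h1.symm, h2, h3⟩

theorem RedEdge.card {R : Λ} {X : Finset V} (h : S.RedEdge R X) : #X = 4 := h.1

theorem BlueEdge.card {R : Λ} {X : Finset V} (h : S.BlueEdge R X) : #X = 4 := h.1

/-- Vertices are added one at a time. A clique of size at most `11` has at most `2 ^ 11 * b`
non-extending vertices, and together with its own vertices these are fewer than `2 ^ 12 * b`. -/
theorem exists_extend [Fintype V] {b : ℝ} (hS : S.Extends b) (hb : 1 ≤ b) {k : ℕ} {A L : Finset V}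
    (hA : S.IsClique A) (hk : #A + k ≤ 12) (hL : 2 ^ 12 * b ≤ #L) :
    ∃ T ⊆ L, #T = k ∧ Disjoint T A ∧ S.IsClique (T ∪ A) := by
  induction k generalizing A with
  | zero => exact ⟨∅, empty_subset _, rfl, disjoint_empty_left _, by simpa using hA⟩
  | succ k ih =>
    obtain ⟨w, hw, hwA, hwc⟩ : ∃ w ∈ L, w ∉ A ∧ S.IsClique (insert w A) := by
      by_contra! hcon
      have h1 := hS.2 A (L \ A) hA fun w hw => hcon w (Finset.mem_sdiff.1 hw).1 (Finset.mem_sdiff.1 hw).2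
      have h2 : #L ≤ #(L \ A) + #A := by
        have := card_le_card_sdiff_add_card (s := L) (t := A)
        omega
      have h3 : (#L : ℝ) ≤ #(L \ A) + #A := by exact_mod_cast h2
      have h4 : (#A : ℝ) ≤ 11 := by exact_mod_cast (by omega : #A ≤ 11)
      have h5 : (2 : ℝ) ^ #A ≤ 2 ^ 11 := pow_le_pow_right₀ (by norm_num) (by omega)
      have h6 : (2 : ℝ) ^ #A * b ≤ 2 ^ 11 * b := by gcongr
      linarith
    obtain ⟨T, hT, hTk, hTA, hTc⟩ := ih hwc (by rw [card_insert_of_notMem hwA]; omega)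
    rw [disjoint_insert_right] at hTA
    refine ⟨insert w T, insert_subset hw hT, by rw [card_insert_of_notMem hTA.1, hTk], ?_, ?_⟩
    · rw [disjoint_insert_left]
      exact ⟨hwA, hTA.2⟩
    · rwa [insert_union, ← union_insert]

/-- Most pairs of vertices extend a clique. -/
theorem card_not_isClique_pair_le [Fintype V] {b : ℝ} (hS : S.Extends b) {A : Finset V}
    (hA : S.IsClique A) (N : Finset (V × V))
    (hN : ∀ p ∈ N, ¬ S.IsClique (insert p.1 (insert p.2 A))) :
    (#N : ℝ) ≤ 2 ^ (#A + 2) * b * Fintype.card V := by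
  classical
  have hb0 : 0 ≤ b := by
    have := hS.2 ∅ ∅ hS.1 (by simp)
    simpa using this
  let N1 : Finset V := univ.filter fun w => ¬ S.IsClique (insert w A)
  let N2 : V → Finset V := fun v => univ.filter fun w => S.IsClique (insert v A) ∧
    ¬ S.IsClique (insert w (insert v A))
  have hsub : N ⊆ (univ ×ˢ N1) ∪ univ.biUnion fun v => (N2 v) ×ˢ {v} := by
    rintro ⟨x, y⟩ hp
    have := hN _ hp
    simp only [mem_union, mem_product, mem_univ, true_and, mem_biUnion, mem_singleton, N1, N2,
      mem_filter]
    by_cases h : S.IsClique (insert y A)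
    · exact Or.inr ⟨y, ⟨h, this⟩, rfl⟩
    · exact Or.inl h
  have h1 : (#N1 : ℝ) ≤ 2 ^ #A * b := hS.2 A N1 hA (by simp [N1])
  have h2 : ∀ v, (#(N2 v) : ℝ) ≤ 2 ^ (#A + 1) * b := by
    intro v
    by_cases hv : S.IsClique (insert v A)
    · refine (hS.2 _ (N2 v) hv (by simp [N2])).trans ?_
      gcongr
      · norm_num
      · exact card_insert_le _ _
    · have : N2 v = ∅ := by simp [N2, hv]
      rw [this]; simp; positivity
  have h3 : #N ≤ Fintype.card V * #N1 + ∑ v : V, #(N2 v) := by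
    refine (card_le_card hsub).trans ((card_union_le _ _).trans ?_)
    refine add_le_add (by rw [card_product, card_univ]) (card_biUnion_le.trans ?_)
    simp
  have h4 : (#N : ℝ) ≤ Fintype.card V * #N1 + ∑ v : V, (#(N2 v) : ℝ) := by exact_mod_cast h3
  have h5 : ∑ v : V, (#(N2 v) : ℝ) ≤ Fintype.card V * (2 ^ (#A + 1) * b) := by
    refine (sum_le_sum fun v _ => h2 v).trans ?_
    simp
  have h6 : (Fintype.card V : ℝ) * #N1 ≤ Fintype.card V * (2 ^ #A * b) := by gcongr
  have h7 : (0 : ℝ) ≤ 2 ^ #A * b * Fintype.card V := by positivity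
  calc (#N : ℝ) ≤ Fintype.card V * (2 ^ #A * b) + Fintype.card V * (2 ^ (#A + 1) * b) := by linarith
    _ = 3 * (2 ^ #A * b * Fintype.card V) := by ring
    _ ≤ 4 * (2 ^ #A * b * Fintype.card V) := by linarith
    _ = _ := by ring

/-- A clique `4`-set with a red pair and a blue pair has one of their labels. -/
theorem redEdge_or_blueEdge {R B : Λ} {X : Finset V} {a b c d : V} (hX : S.IsClique X)
    (h4 : #X = 4) (ha : a ∈ X) (hb : b ∈ X) (hc : c ∈ X) (hd : d ∈ X) (hab : a ≠ b)
    (hred : S.pcol {a, b}) (hR : S.pcomp {a, b} = R) (hblue : S.BluePair B c d) :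
    S.RedEdge R X ∨ S.BlueEdge B X := by
  by_cases h : S.col X
  · refine Or.inl ⟨h4, hX, h, ?_⟩
    rw [← hR]
    exact S.comp_eq_pcomp hX h4 (by simp [insert_subset_iff, ha, hb]) (card_pair hab) (by tauto)
  · refine Or.inr ⟨h4, hX, h, ?_⟩
    rw [← hblue.2.2.2]
    refine S.comp_eq_pcomp hX h4 (by simp [insert_subset_iff, hc, hd]) (card_pair hblue.1) ?_
    have := hblue.2.2.1
    tauto

theorem blueEdge_of_bluePair {B : Λ} {X : Finset V} {c d : V} (hX : S.IsClique X)
    (h4 : #X = 4) (hc : c ∈ X) (hd : d ∈ X) (hblue : S.BluePair B c d) (h : ¬ S.col X) :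
    S.BlueEdge B X := by
  refine ⟨h4, hX, h, ?_⟩
  rw [← hblue.2.2.2]
  refine S.comp_eq_pcomp hX h4 (by simp [insert_subset_iff, hc, hd]) (card_pair hblue.1) ?_
  have := hblue.2.2.1
  tauto

theorem BluePair.trans_of_not_pcol {B : Λ} {a b c : V} (h : S.BluePair B a b) (hac : a ≠ c)
    (hbc : b ≠ c) (hcl : S.IsClique {a, b, c}) (h' : ¬ S.pcol {a, c}) : S.BluePair B a c := by
  refine ⟨hac, S.mono (by intro x; simp; tauto) hcl, h', ?_⟩
  rw [← h.2.2.2]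
  exact (S.pcomp_eq_pcomp h.1 hac hbc hcl (by have := h.2.2.1; tauto)).symm

/-- Two clique `4`-sets of the same colour that share three vertices have the same label. -/
theorem comp_insert_eq {T : Finset V} {x y : V} (hT : #T = 3) (hx : x ∉ T) (hy : y ∉ T)
    (hcx : S.IsClique (insert x T)) (hcy : S.IsClique (insert y T))
    (h : S.col (insert x T) ↔ S.col (insert y T)) : S.comp (insert x T) = S.comp (insert y T) := by
  by_cases hxy : x = y
  · rw [hxy]
  · refine S.comp_eq_comp hcx hcy (by rw [card_insert_of_notMem hx, hT])
      (by rw [card_insert_of_notMem hy, hT]) ?_ h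
    have : insert x T ∩ insert y T = T := by
      ext z
      simp only [mem_inter, mem_insert]
      constructor
      · rintro ⟨rfl | h1, rfl | h2⟩ <;> first | assumption | exact absurd rfl hxy
      · exact fun h => ⟨Or.inr h, Or.inr h⟩
    rw [this, hT]

end

end CliqueSystem

namespace CliqueSystem

section
variable {V Λ : Type*} [DecidableEq V] {S : CliqueSystem V Λ}

/-! ### Unifying the labels of pairs, and a first matching -/

/-- If all `4`-sets between `P` and a clique `W` have the same colour, they have the same label. -/
theorem comp_eq_of_col {W P X Y : Finset V} (hW : S.IsClique W) (κ : Prop)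
    (hcol : ∀ Z, P ⊆ Z → Z ⊆ W → #Z = 4 → (S.col Z ↔ κ)) (hPX : P ⊆ X) (hX : X ⊆ W) (hX4 : #X = 4)
    (hPY : P ⊆ Y) (hY : Y ⊆ W) (hY4 : #Y = 4) : S.comp X = S.comp Y := by
  -- Vertices of `X` are exchanged for vertices of `Y` one by one; the intermediate sets still lie
  -- between `P` and `W`, so they have the same colour and consecutive ones share three vertices.
  induction h : #(Y \ X) generalizing X with
  | zero =>
    rw [card_eq_zero, sdiff_eq_empty_iff_subset] at h
    rw [eq_of_subset_of_card_le h (by omega)]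
  | succ k ih =>
    obtain ⟨y, hy⟩ : (Y \ X).Nonempty := card_pos.1 (by omega)
    obtain ⟨x, hx⟩ : (X \ Y).Nonempty := by
      rw [← card_pos, ← card_sdiff_comm (by omega : #Y = #X)]
      omega
    rw [Finset.mem_sdiff] at hx hy
    have hyE : y ∉ X.erase x := fun h => hy.2 (mem_of_mem_erase h)
    have hT : #(X.erase x) = 3 := by rw [card_erase_of_mem hx.1]; omega
    have hXi : insert x (X.erase x) = X := insert_erase hx.1
    have h4 : #(insert y (X.erase x)) = 4 := by rw [card_insert_of_notMem hyE, hT]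
    have hPE : P ⊆ X.erase x := fun v hv => mem_erase.2 ⟨fun h => hx.2 (h ▸ hPY hv), hPX hv⟩
    have hW' : insert y (X.erase x) ⊆ W := insert_subset (hY hy.1) ((erase_subset _ _).trans hX)
    have hP' : P ⊆ insert y (X.erase x) := hPE.trans (subset_insert _ _)
    rw [← ih hP' hW' h4]
    · conv_lhs => rw [← hXi]
      refine comp_insert_eq hT (notMem_erase _ _) hyE (by rw [hXi]; exact S.mono hX hW)
        (S.mono hW' hW) ?_
      rw [hXi, hcol X hPX hX hX4, hcol _ hP' hW' h4]
    · have : Y \ insert y (X.erase x) = (Y \ X).erase y := by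
        ext v
        simp only [Finset.mem_sdiff, mem_insert, mem_erase, not_or, not_and]
        constructor
        · rintro ⟨h1, h2, h3⟩
          exact ⟨h2, h1, h3 (fun h => hx.2 (h ▸ h1))⟩
        · rintro ⟨h1, h2, h3⟩
          exact ⟨h2, h1, fun _ => h3⟩
      rw [this, card_erase_of_mem (Finset.mem_sdiff.2 hy), h]
      rfl

theorem pcomp_eq {W : Finset V} (hW : S.IsClique W) {a b c : V} (ha : a ∈ W) (hb : b ∈ W)
    (hc : c ∈ W) (hab : a ≠ b) (hac : a ≠ c) (hbc : b ≠ c) (h : S.pcol {a, b} ↔ S.pcol {a, c}) :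
    S.pcomp {a, b} = S.pcomp {a, c} :=
  S.pcomp_eq_pcomp hab hac hbc (S.mono (by simp [insert_subset_iff, ha, hb, hc]) hW) h

/-- In the link of some clique, all red pairs or all blue pairs have the same label. -/
theorem exists_link_pcomp_eq [Nonempty Λ] (h0 : S.IsClique ∅) :
    ∃ q, S.IsClique q ∧ #q ≤ 4 ∧
      ((∃ R, ∀ a b, a ≠ b → (S.link q).IsClique {a, b} → S.pcol {a, b} → S.pcomp {a, b} = R) ∨
       (∃ B, ∀ a b, a ≠ b → (S.link q).IsClique {a, b} → ¬ S.pcol {a, b} → S.pcomp {a, b} = B)) := by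
  by_cases h : ∃ x y z w, x ≠ y ∧ x ≠ z ∧ x ≠ w ∧ y ≠ z ∧ y ≠ w ∧ z ≠ w ∧ S.IsClique {x, y, z, w} ∧
      S.pcol {x, y} ∧ S.pcol {z, w} ∧ S.pcomp {x, y} ≠ S.pcomp {z, w}
  · obtain ⟨x, y, z, w, hxy, hxz, hxw, hyz, hyw, hzw, hc, h1, h2, hne⟩ := h
    -- Adjacent red pairs share a label, so no path of red pairs joins `{x, y}` to `{z, w}`. Hence
    -- `{x, z}` is blue, and any further vertex `a` forms a blue pair with `x` or with `z`, which
    -- ties `{a, b}` to `{x, z}`.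
    refine ⟨{x, y, z, w}, hc, card_le_four, Or.inr ⟨S.pcomp {x, z}, ?_⟩⟩
    rintro a b hab ⟨hdis, hcl⟩ hblue
    simp only [disjoint_insert_right, disjoint_singleton_right, mem_insert, mem_singleton,
      not_or] at hdis
    obtain ⟨⟨hxa, hxb⟩, ⟨hya, -⟩, ⟨hza, hzb⟩, hwa, -⟩ := hdis
    have adj := fun {a b c : V} => pcomp_eq hcl (a := a) (b := b) (c := c)
    have e1 : S.pcol {x, z} → S.pcol {x, y} → False := fun h h' => hne <| by
      rw [adj (a := x) (b := y) (c := z) (by simp) (by simp) (by simp) hxy hxz hyz (by tauto),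
        pair_comm, adj (a := z) (b := x) (c := w) (by simp) (by simp) (by simp) hxz.symm hzw hxw]
      rw [pair_comm z x]; tauto
    have hbxz : ¬ S.pcol {x, z} := fun h => e1 h h1
    by_cases hax : S.pcol {a, x}
    · by_cases haz : S.pcol {a, z}
      · refine absurd ?_ hne
        rw [adj (a := x) (b := y) (c := a) (by simp) (by simp) (by simp) hxy hxa hya
          (by rw [pair_comm x a]; tauto), pair_comm x a,
          adj (a := a) (b := x) (c := z) (by simp) (by simp) (by simp) (Ne.symm hxa) (Ne.symm hza) hxz
          (by tauto), pair_comm a z,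
          adj (a := z) (b := a) (c := w) (by simp) (by simp) (by simp) hza hzw (Ne.symm hwa)
          (by rw [pair_comm z a]; tauto)]
      · rw [adj (a := a) (b := b) (c := z) (by simp) (by simp) (by simp) hab (Ne.symm hza)
          (Ne.symm hzb) (by tauto), pair_comm a z,
          adj (a := z) (b := a) (c := x) (by simp) (by simp) (by simp) hza hxz.symm (Ne.symm hxa)
          (by rw [pair_comm z a, pair_comm z x]; tauto), pair_comm]
    · rw [adj (a := a) (b := b) (c := x) (by simp) (by simp) (by simp) hab (Ne.symm hxa)
          (Ne.symm hxb) (by tauto), pair_comm a x,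
          adj (a := x) (b := a) (c := z) (by simp) (by simp) (by simp) hxa hxz (Ne.symm hza)
          (by rw [pair_comm x a]; tauto)]
  · push Not at h
    by_cases h2 : ∃ x y, x ≠ y ∧ S.IsClique {x, y} ∧ S.pcol {x, y}
    · obtain ⟨x, y, hxy, hc, hr⟩ := h2
      -- Disjoint red pairs of a common clique now agree, so in the link of one red pair every red
      -- pair has its label.
      refine ⟨{x, y}, hc, card_le_two.trans (by norm_num), Or.inl ⟨S.pcomp {x, y}, ?_⟩⟩
      rintro a b hab ⟨hdis, hcl⟩ hred
      simp only [disjoint_insert_right, disjoint_singleton_right, mem_insert, mem_singleton,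
        not_or] at hdis
      refine h a b x y hab (Ne.symm hdis.1.1) (Ne.symm hdis.2.1) (Ne.symm hdis.1.2)
        (Ne.symm hdis.2.2) hxy ?_ hred hr
      refine S.mono ?_ hcl
      intro v; simp; tauto
    · push Not at h2
      refine ⟨∅, h0, by simp, Or.inl ⟨Classical.arbitrary Λ, fun a b hab hcl hred => ?_⟩⟩
      exact absurd hred (h2 a b hab (by simpa using hcl.2))

/-- Compared with `card_not_isClique_pair_le`, the diagonal and the pairs meeting `A` are also
allowed in `N`; they cost one more factor of two. -/
theorem card_pairs_le [Fintype V] {b : ℝ} (hS : S.Extends b) (hb : 1 ≤ b) {A : Finset V}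
    (hA : S.IsClique A) (N : Finset (V × V))
    (hN : ∀ x y, (x, y) ∈ N → x ≠ y → x ∉ A → y ∉ A → ¬ S.IsClique (insert x (insert y A))) :
    (#N : ℝ) ≤ 2 ^ (#A + 3) * b * Fintype.card V := by
  classical
  let N1 := N.filter fun p => ¬ S.IsClique (insert p.1 (insert p.2 A))
  have hsub : N ⊆ (N1 ∪ (univ.image fun v : V => (v, v))) ∪ (A ×ˢ univ ∪ univ ×ˢ A) := by
    rintro ⟨x, y⟩ hp
    simp only [N1, mem_union, mem_filter, mem_image, mem_univ, true_and, mem_product, and_true,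
      Prod.mk.injEq]
    by_contra! hcon
    obtain ⟨⟨h1, h2⟩, h3, h4⟩ := hcon
    exact hN x y hp (fun h => h2 x rfl h) h3 h4 (h1 hp)
  have h1 := card_not_isClique_pair_le hS hA N1 (by simp [N1])
  have h2 : #N ≤ #N1 + Fintype.card V + 2 * #A * Fintype.card V := by
    refine (card_le_card hsub).trans ((card_union_le _ _).trans ?_)
    have e1 := card_union_le N1 (univ.image fun v : V => (v, v))
    have e2 := card_union_le (A ×ˢ (univ : Finset V)) (univ ×ˢ A)
    have e3 : #(univ.image fun v : V => (v, v)) ≤ Fintype.card V := card_image_le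
    rw [card_product, card_product, card_univ] at e2
    nlinarith
  have h3 : (#N : ℝ) ≤ #N1 + Fintype.card V + 2 * #A * Fintype.card V := by exact_mod_cast h2
  have h4 : (#A : ℝ) + 1 ≤ 2 ^ #A := by exact_mod_cast Nat.lt_two_pow_self
  have h5 : (1 + 2 * (#A : ℝ)) * Fintype.card V ≤ 2 ^ (#A + 2) * b * Fintype.card V := by
    gcongr
    rw [pow_add]
    nlinarith
  calc (#N : ℝ) ≤ 2 ^ (#A + 2) * b * Fintype.card V + 2 ^ (#A + 2) * b * Fintype.card V := by linarith
    _ = _ := by ring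

/-- A maximum matching of red edges, completed in a suitable way by blue edges, leaves a set of
vertices in which most pairs are blue with the same label, unless it leaves few vertices. -/
theorem hasCover_or_exists_matching [Fintype V] {b m : ℝ} (hS : S.Extends b) (hb : 1 ≤ b) {R : Λ}
    (hR : ∀ x y, x ≠ y → S.IsClique {x, y} → S.pcol {x, y} → S.pcomp {x, y} = R)
    (hm : 2 ^ 12 * b ≤ m) :
    S.HasCover m ∨ ∃ (B : Λ) (M : Finset (Finset V)), (M : Set (Finset V)).PairwiseDisjoint id ∧
      (∀ e ∈ M, S.RedEdge R e ∨ S.BlueEdge B e) ∧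
      ∀ N : Finset (V × V), (∀ x y, (x, y) ∈ N → x ∉ coveredVertices M ∧ y ∉ coveredVertices M ∧
        ¬ S.BluePair B x y) → (#N : ℝ) ≤ 2 ^ 7 * b * Fintype.card V := by
  classical
  obtain ⟨M, hM, hMd, hMmax⟩ := exists_maximal_matching (S.RedEdge R)
    (fun e he => card_pos.1 (by rw [he.card]; norm_num)) univ
  set U := univ \ coveredVertices M with hU
  by_cases hUm : (#U : ℝ) ≤ m
  · refine Or.inl ⟨M, R, R, hMd, fun e he => Or.inl (hM e he).1, ?_⟩
    rwa [compl_eq_univ_sdiff]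
  push Not at hUm
  -- A red pair has label `R`, so a red `4`-clique containing it would be a red edge that `M` could
  -- still take.
  have hblue : ∀ X ⊆ U, S.IsClique X → #X = 4 → ∀ x ∈ X, ∀ y ∈ X, x ≠ y → S.pcol {x, y} →
      ¬ S.col X := by
    intro X hXU hX h4 x hx y hy hxy hp hc
    have hs : ({x, y} : Finset V) ⊆ X := by simp [insert_subset_iff, hx, hy]
    refine hMmax X ⟨h4, hX, hc, ?_⟩ hXU
    rw [← hR x y hxy (S.mono hs hX) hp]
    exact S.comp_eq_pcomp hX h4 hs (card_pair hxy) (by tauto)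
  refine or_iff_not_imp_left.2 fun hno => ?_
  by_cases hred : ∃ x ∈ U, ∃ y ∈ U, x ≠ y ∧ S.IsClique {x, y} ∧ S.pcol {x, y}
  · obtain ⟨x, hx, y, hy, hxy, hcl, hp⟩ := hred
    obtain ⟨T, hTU, hT2, hTd, hTc⟩ := exists_extend hS hb (k := 2) hcl
      (by rw [card_pair hxy]; norm_num) (hm.trans hUm.le)
    set Q := T ∪ {x, y} with hQ
    have hQ4 : #Q = 4 := by rw [hQ, card_union_of_disjoint hTd, hT2, card_pair hxy]
    have hQU : Q ⊆ U := union_subset hTU (by simp [insert_subset_iff, hx, hy])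
    have hxQ : x ∈ Q := by simp [hQ]
    have hyQ : y ∈ Q := by simp [hQ]
    -- The blue label is dictated by a `4`-clique around a red pair of the leftover: every such
    -- `4`-set is blue.
    set B := S.comp Q
    obtain ⟨M', hM', hMd', hMmax'⟩ := exists_maximal_matching (S.BlueEdge B)
      (fun e he => card_pos.1 (by rw [he.card]; norm_num)) U
    have hcov : coveredVertices (M ∪ M') = coveredVertices M ∪ coveredVertices M' := by
      rw [coveredVertices, union_biUnion]; rfl
    have hUd : U \ coveredVertices M' = (coveredVertices (M ∪ M'))ᶜ := by
      ext v; simp [hU, hcov]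
    have hd : ((M ∪ M' : Finset (Finset V)) : Set (Finset V)).PairwiseDisjoint id := by
      rw [coe_union, Set.pairwiseDisjoint_union]
      refine ⟨hMd, hMd', fun e he f hf _ => ?_⟩
      refine Finset.disjoint_left.2 fun v hv hv' => ?_
      have h1 := (hM' f hf).2 hv'
      rw [hU, Finset.mem_sdiff] at h1
      exact h1.2 (mem_biUnion.2 ⟨e, he, hv⟩)
    have he : ∀ e ∈ M ∪ M', S.RedEdge R e ∨ S.BlueEdge B e := by
      intro e he
      rcases mem_union.1 he with h | h
      · exact Or.inl (hM e h).1
      · exact Or.inr (hM' e h).1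
    refine ⟨B, M ∪ M', hd, he, fun N hN => ?_⟩
    have hL : m < #(U \ coveredVertices M') := by
      by_contra! hcon
      exact hno ⟨_, R, B, hd, he, by rwa [← hUd]⟩
    refine (card_pairs_le hS hb hTc N ?_).trans_eq (by rw [hQ4])
    intro a c hac hne haQ hcQ hcl'
    obtain ⟨ha, hc, hnot⟩ := hN a c hac
    have haU : a ∈ U := sdiff_subset (by rw [hUd, mem_compl]; exact ha : a ∈ U \ coveredVertices M')
    have hcU : c ∈ U := sdiff_subset (by rw [hUd, mem_compl]; exact hc : c ∈ U \ coveredVertices M')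
    apply hnot
    have hsub : ({x, y, a, c} : Finset V) ⊆ insert a (insert c Q) := by
      simp [insert_subset_iff, hxQ, hyQ]
    have hxa : x ≠ a := fun h => haQ (h ▸ hxQ)
    have hxc : x ≠ c := fun h => hcQ (h ▸ hxQ)
    have hya : y ≠ a := fun h => haQ (h ▸ hyQ)
    have hyc : y ≠ c := fun h => hcQ (h ▸ hyQ)
    have h4 : #({x, y, a, c} : Finset V) = 4 := by
      rw [card_insert_of_notMem, card_insert_of_notMem, card_pair hne] <;> simp [*]
    have hWU : insert a (insert c Q) ⊆ U := insert_subset haU (insert_subset hcU hQU)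
    have hcomp : S.comp {x, y, a, c} = B := by
      refine comp_eq_of_col (P := {x, y}) hcl' False ?_ ?_ hsub h4 ?_ ?_ hQ4
      · intro Z hPZ hZ hZ4
        simp only [iff_false]
        exact hblue Z (hZ.trans hWU) (S.mono hZ hcl') hZ4 x (hPZ (by simp)) y (hPZ (by simp)) hxy hp
      · intro v; simp; tauto
      · simp [insert_subset_iff, hxQ, hyQ]
      · exact (subset_insert _ _).trans (subset_insert _ _)
    have hcolx : ¬ S.col {x, y, a, c} :=
      hblue _ (hsub.trans hWU) (S.mono hsub hcl') h4 x (by simp) y (by simp) hxy hp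
    -- If `{a, c}` were red, all `4`-cliques of `U` around it would be blue, so two further leftover
    -- vertices would complete it to a blue edge connected to `{x, y, a, c}`, contradicting the
    -- maximality of `M'`.
    by_cases hpac : S.pcol {a, c}
    · exfalso
      obtain ⟨T', hT'U, hT'2, hT'd, hT'c⟩ := exists_extend hS hb (k := 2) hcl' (by
        have := card_insert_le a (insert c Q)
        have := card_insert_le c Q
        omega) (hm.trans hL.le)
      have hZU : T' ∪ insert a (insert c Q) ⊆ U := union_subset (hT'U.trans sdiff_subset) hWU
      have hX : T' ∪ {a, c} ⊆ T' ∪ insert a (insert c Q) := by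
        refine union_subset_union_right ?_
        simp [insert_subset_iff]
      have hX4 : #(T' ∪ {a, c}) = 4 := by
        rw [card_union_of_disjoint, hT'2, card_pair hne]
        exact hT'd.mono_right (by simp [insert_subset_iff])
      refine hMmax' (T' ∪ {a, c}) ⟨hX4, S.mono hX hT'c, ?_, ?_⟩ ?_
      · exact hblue _ (hX.trans hZU) (S.mono hX hT'c) hX4 a (by simp) c (by simp) hne hpac
      · rw [← hcomp]
        refine comp_eq_of_col (P := {a, c}) hT'c False ?_ subset_union_right hX hX4 ?_
          (hsub.trans subset_union_right) h4
        · intro Z hPZ hZ hZ4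
          simp only [iff_false]
          exact hblue Z (hZ.trans hZU) (S.mono hZ hT'c) hZ4 a (hPZ (by simp)) c (hPZ (by simp)) hne
            hpac
        · intro v; simp; tauto
      · refine union_subset hT'U ?_
        rw [hUd]
        simp [insert_subset_iff, ha, hc]
    · have hs : ({a, c} : Finset V) ⊆ {x, y, a, c} := by intro v; simp; tauto
      refine ⟨hne, S.mono (hs.trans hsub) hcl', hpac, ?_⟩
      rw [← hcomp]
      exact (S.comp_eq_pcomp (S.mono hsub hcl') h4 hs (card_pair hne) (by tauto)).symm
  -- With no red pair in the leftover, blue adjacency to one fixed pair gives the label.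
  · push Not at hred
    obtain ⟨T, hTU, hT2, -, hTc⟩ := exists_extend hS hb (k := 2) hS.1 (by simp) (hm.trans hUm.le)
    rw [union_empty] at hTc
    obtain ⟨x, y, hxy, rfl⟩ := card_eq_two.1 hT2
    have hx : x ∈ U := hTU (by simp)
    refine ⟨S.pcomp {x, y}, M, hMd, fun e he => Or.inl (hM e he).1, fun N hN => ?_⟩
    refine (card_pairs_le hS hb hTc N ?_).trans ?_
    · intro a c hac hne haQ hcQ hcl'
      obtain ⟨ha, hc, hnot⟩ := hN a c hac
      have haU : a ∈ U := by simp [hU, ha]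
      have hcU : c ∈ U := by simp [hU, hc]
      simp only [mem_insert, mem_singleton, not_or] at haQ hcQ
      have hac' : S.IsClique {a, c} := S.mono (by simp [insert_subset_iff]) hcl'
      have hxa' : S.IsClique {x, a} := S.mono (by simp [insert_subset_iff]) hcl'
      have h1 := hred a haU c hcU hne hac'
      have h2 := hred x hx a haU (Ne.symm haQ.1) hxa'
      have h3 := hred x hx y (hTU (by simp)) hxy hTc
      refine hnot ⟨hne, hac', h1, ?_⟩
      rw [pcomp_eq hcl' (a := x) (b := y) (c := a) (by simp) (by simp) (by simp) hxy
        (Ne.symm haQ.1) (Ne.symm haQ.2) (by tauto), pair_comm x a,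
        pcomp_eq hcl' (a := a) (b := x) (c := c) (by simp) (by simp) (by simp) haQ.1 hne
        (Ne.symm hcQ.1) (by rw [pair_comm a x]; tauto)]
    · rw [card_pair hxy]
      gcongr <;> norm_num

/-! ### Leftovers without edges of either label -/

/-- In a clique that contains no red or blue edge, one blue pair makes all pairs blue. -/
theorem bluePair_of_free {R B : Λ} {W : Finset V} (hW : S.IsClique W) (h4 : 4 ≤ #W)
    (hR : ∀ x y, x ≠ y → S.IsClique {x, y} → S.pcol {x, y} → S.pcomp {x, y} = R)
    (hfree : ∀ X ⊆ W, ¬ S.RedEdge R X ∧ ¬ S.BlueEdge B X) {u v : V} (hu : u ∈ W) (hv : v ∈ W)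
    (huv : S.BluePair B u v) {x y : V} (hx : x ∈ W) (hy : y ∈ W) (hxy : x ≠ y) :
    S.BluePair B x y := by
  -- A `4`-set containing a red `R`-pair and a blue `B`-pair is an edge of one of the two labels,
  -- whichever colour it has.
  have key : ∀ x ∈ W, ∀ y ∈ W, x ≠ y → ¬ S.pcol {x, y} := by
    intro x hx y hy hxy hp
    obtain ⟨X, hX1, hX2, hX3⟩ := exists_subsuperset_card_eq (s := {u, v, x, y}) (t := W) (n := 4)
      (by simp [insert_subset_iff, hx, hy, hu, hv]) card_le_four h4
    rcases redEdge_or_blueEdge (R := R) (B := B) (S.mono hX2 hW) hX3 (hX1 (by simp : x ∈ _))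
      (hX1 (by simp : y ∈ _)) (hX1 (by simp : u ∈ _)) (hX1 (by simp : v ∈ _)) hxy hp
      (hR x y hxy (S.mono (by simp [insert_subset_iff, hx, hy]) hW) hp) huv with h | h
    · exact (hfree X hX2).1 h
    · exact (hfree X hX2).2 h
  have h1 : ∀ x ∈ W, x ≠ u → S.BluePair B u x := by
    intro x hx hxu
    by_cases hxv : x = v
    · rwa [hxv]
    · exact huv.trans_of_not_pcol (Ne.symm hxu) (Ne.symm hxv)
        (S.mono (by simp [insert_subset_iff, hx, hu, hv]) hW) (key u hu x hx (Ne.symm hxu))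
  by_cases hxu : x = u
  · subst hxu
    exact h1 y hy hxy.symm
  · by_cases hyu : y = u
    · subst hyu
      exact (h1 x hx hxy).symm
    · exact (h1 x hx hxu).symm.trans_of_not_pcol hxy (Ne.symm hyu)
        (S.mono (by simp [insert_subset_iff, hx, hu, hy]) hW) (key x hx y hy hxy)

/-- All pairs of `W` are blue with label `B`, so a blue `4`-set would be a blue `B`-edge. What
remains is a red label different from `R`, which can later take the place of `R`. -/
theorem col_of_free {R B : Λ} {W : Finset V} (hW : S.IsClique W) (h4 : 4 ≤ #W)
    (hR : ∀ x y, x ≠ y → S.IsClique {x, y} → S.pcol {x, y} → S.pcomp {x, y} = R)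
    (hfree : ∀ X ⊆ W, ¬ S.RedEdge R X ∧ ¬ S.BlueEdge B X) {u v : V} (hu : u ∈ W) (hv : v ∈ W)
    (huv : S.BluePair B u v) {X : Finset V} (hX : X ⊆ W) (hX4 : #X = 4) :
    S.col X ∧ S.comp X ≠ R := by
  have hcol : S.col X := by
    by_contra h
    obtain ⟨x, hx, y, hy, hxy⟩ := one_lt_card.1 (by omega : 1 < #X)
    exact (hfree X hX).2 (blueEdge_of_bluePair (S.mono hX hW) hX4 hx hy
      (bluePair_of_free hW h4 hR hfree hu hv huv (hX hx) (hX hy) hxy) h)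
  exact ⟨hcol, fun h => (hfree X hX).1 ⟨hX4, S.mono hX hW, hcol, h⟩⟩

/-- A matching of blue edges can be completed if it leaves no red or blue edge but a blue pair. -/
theorem hasCover_of_forall_blueEdge [Fintype V] {b m : ℝ} (hS : S.Extends b) (hb : 1 ≤ b) {R B : Λ}
    (hR : ∀ x y, x ≠ y → S.IsClique {x, y} → S.pcol {x, y} → S.pcomp {x, y} = R)
    (hm : 2 ^ 12 * b ≤ m) {M : Finset (Finset V)} (hMd : (M : Set (Finset V)).PairwiseDisjoint id)
    (hM : ∀ e ∈ M, S.BlueEdge B e) {L : Finset V} (hL : L = (coveredVertices M)ᶜ)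
    (hfree : ∀ X ⊆ L, ¬ S.RedEdge R X ∧ ¬ S.BlueEdge B X) {u v : V} (hu : u ∈ L) (hv : v ∈ L)
    (huv : S.BluePair B u v) : S.HasCover m := by
  by_cases hLm : (#L : ℝ) ≤ m
  · exact ⟨M, R, B, hMd, fun e he => Or.inr (hM e he), by rwa [← hL]⟩
  push Not at hLm
  obtain ⟨T, hTL, hT2, hTd, hTc⟩ := exists_extend hS hb (k := 2) huv.2.1
    (by rw [card_pair huv.1]; norm_num) (hm.trans hLm.le)
  set Q := T ∪ {u, v} with hQ
  have hQ4 : #Q = 4 := by rw [hQ, card_union_of_disjoint hTd, hT2, card_pair huv.1]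
  have hQL : Q ⊆ L := union_subset hTL (by simp [insert_subset_iff, hu, hv])
  -- Since `M` uses no red edge, the red label may be changed from `R` to that of `Q`.
  obtain ⟨M', hM', hMd', hMmax'⟩ := exists_maximal_matching (S.RedEdge (S.comp Q))
      (fun e he => card_pos.1 (by rw [he.card]; norm_num)) L
  have hcov : coveredVertices (M ∪ M') = coveredVertices M ∪ coveredVertices M' := by
    rw [coveredVertices, union_biUnion]; rfl
  have hLd : L \ coveredVertices M' = (coveredVertices (M ∪ M'))ᶜ := by
    ext v; simp [hL, hcov]
  have hd : ((M ∪ M' : Finset (Finset V)) : Set (Finset V)).PairwiseDisjoint id := by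
    rw [coe_union, Set.pairwiseDisjoint_union]
    refine ⟨hMd, hMd', fun e he f hf _ => ?_⟩
    refine Finset.disjoint_left.2 fun v hv hv' => ?_
    have h1 := (hM' f hf).2 hv'
    rw [hL, mem_compl] at h1
    exact h1 (mem_biUnion.2 ⟨e, he, hv⟩)
  refine ⟨M ∪ M', S.comp Q, B, hd, fun e he => ?_, ?_⟩
  · rcases mem_union.1 he with h | h
    · exact Or.inr (hM e h)
    · exact Or.inl (hM' e h).1
  rw [← hLd]
  by_contra! hcon
  obtain ⟨T', hT'L, hT'4, hT'd, hT'c⟩ := exists_extend hS hb (k := 4) hTc (by omega)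
    (hm.trans hcon.le)
  have hWL : T' ∪ Q ⊆ L := union_subset (hT'L.trans sdiff_subset) hQL
  have hcol : ∀ Z ⊆ T' ∪ Q, #Z = 4 → S.col Z := fun Z hZ hZ4 =>
    (col_of_free hT'c (hQ4.symm.le.trans (card_le_card subset_union_right)) hR
      (fun X hX => hfree X (hX.trans hWL)) (u := u) (v := v) (by simp [hQ]) (by simp [hQ]) huv hZ
      hZ4).1
  -- All `4`-sets of `T' ∪ Q` are red, so exchanging vertices connects `T'` to `Q`; `T'` is then a
  -- red edge missed by `M'`.
  refine hMmax' T' ⟨hT'4, S.mono subset_union_left hT'c, hcol _ subset_union_left hT'4, ?_⟩ hT'L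
  refine comp_eq_of_col (P := ∅) hT'c True ?_ (empty_subset _) subset_union_left hT'4
    (empty_subset _) subset_union_right hQ4
  intro Z _ hZ hZ4
  simp [hcol Z hZ hZ4]

end

end CliqueSystem

/-! ### Exchanging a red edge for blue edges -/

/-- Greedily choose disjoint completions in `L` of as many members of `F` as possible. -/
theorem exists_greedy_completion {V : Type*} [DecidableEq V] (E : Finset V → Prop)
    (F : Finset (Finset V)) (L : Finset V) :
    ∃ A ⊆ F, ∃ P : Finset V → Finset V, ∃ L' ⊆ L, #L ≤ #L' + 3 * #F ∧
      (∀ X ∈ A, P X ⊆ L ∧ Disjoint (P X) L' ∧ #(P X) ≤ 3 ∧ E (X ∪ P X)) ∧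
      (A : Set (Finset V)).PairwiseDisjoint P ∧
      ∀ X ∈ F, X ∉ A → ∀ T ⊆ L', #T ≤ 3 → ¬ E (X ∪ T) := by
  induction F using Finset.induction_on with
  | empty => exact ⟨∅, by simp, fun _ => ∅, L, Subset.rfl, by simp⟩
  | insert X F hX ih =>
    obtain ⟨A, hAF, P, L', hL', hc, hA, hd, hun⟩ := ih
    rw [card_insert_of_notMem hX]
    -- The pool only shrinks, so a set that cannot be completed remains so, while each success uses
    -- at most three vertices.
    by_cases h : ∃ T ⊆ L', #T ≤ 3 ∧ E (X ∪ T)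
    · obtain ⟨T, hT, hT3, hET⟩ := h
      have hXA : X ∉ A := fun h => hX (hAF h)
      have hP : ∀ Y ∈ A, Function.update P X T Y = P Y := fun Y hY =>
        Function.update_of_ne (by rintro rfl; exact hXA hY) _ _
      refine ⟨insert X A, insert_subset_insert _ hAF, Function.update P X T, L' \ T,
        sdiff_subset.trans hL', ?_, ?_, ?_, ?_⟩
      · have := card_le_card_sdiff_add_card (s := L') (t := T)
        omega
      · intro Y hY
        rcases mem_insert.1 hY with rfl | hY
        · simp only [Function.update_self]
          exact ⟨hT.trans hL', disjoint_sdiff, hT3, hET⟩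
        · rw [hP Y hY]
          obtain ⟨h1, h2, h3, h4⟩ := hA Y hY
          exact ⟨h1, h2.mono_right sdiff_subset, h3, h4⟩
      · rw [coe_insert, Set.pairwiseDisjoint_insert]
        refine ⟨fun Y hY Z hZ hYZ => ?_, fun Y hY _ => ?_⟩
        · change Disjoint (Function.update P X T Y) (Function.update P X T Z)
          rw [hP Y hY, hP Z hZ]
          exact hd hY hZ hYZ
        · rw [hP Y hY, Function.update_self]
          exact ((hA Y hY).2.1.mono_right hT).symm
      · intro Y hY hYA U hU hU3
        rw [mem_insert, not_or] at hYA
        exact hun Y ((mem_insert.1 hY).resolve_left hYA.1) hYA.2 U (hU.trans sdiff_subset) hU3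
    · push Not at h
      refine ⟨A, hAF.trans (subset_insert _ _), P, L', hL', by omega, hA, hd, ?_⟩
      intro Y hY hYA U hU hU3
      rcases mem_insert.1 hY with rfl | hY
      · exact h U hU hU3
      · exact hun Y hY hYA U hU hU3

namespace CliqueSystem

section
variable {V Λ : Type*} [DecidableEq V] {S : CliqueSystem V Λ}

/-- A vertex that forms no blue edge with a clique `D` of blue pairs forms red edges and blue pairs
with it. -/
theorem bluePair_of_forall_not_blueEdge {R B : Λ} {D : Finset V} {v : V} (hD : #D = 4)
    (hv : v ∉ D) (hcl : S.IsClique (insert v D))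
    (hR : ∀ x y, x ≠ y → S.IsClique {x, y} → S.pcol {x, y} → S.pcomp {x, y} = R)
    (hDb : ∀ x ∈ D, ∀ y ∈ D, x ≠ y → S.BluePair B x y) (hDc : S.col D) (hDR : S.comp D ≠ R)
    (hun : ∀ T ⊆ D, #T = 3 → ¬ S.BlueEdge B (insert v T)) :
    (∀ T ⊆ D, #T = 3 → S.col (insert v T) ∧ S.comp (insert v T) = S.comp D) ∧
      ∀ t ∈ D, S.BluePair B v t := by
  have h1 : ∀ T ⊆ D, #T = 3 → S.col (insert v T) ∧ S.comp (insert v T) = S.comp D := by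
    intro T hT hT3
    have hvT : v ∉ T := fun h => hv (hT h)
    have hc4 : #(insert v T) = 4 := by rw [card_insert_of_notMem hvT, hT3]
    have hcT : S.IsClique (insert v T) := S.mono (insert_subset_insert _ hT) hcl
    -- A blue `4`-set would contain a blue `B`-pair of `T` and be a `B`-edge. The red `4`-sets share
    -- three vertices with `D` and so have its label, not `R`, which also rules out red pairs at
    -- `v`.
    have hcol : S.col (insert v T) := by
      by_contra h
      obtain ⟨x, hx, y, hy, hxy⟩ := one_lt_card.1 (by omega : 1 < #T)
      exact hun T hT hT3 (blueEdge_of_bluePair hcT hc4 (mem_insert_of_mem hx)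
        (mem_insert_of_mem hy) (hDb x (hT hx) y (hT hy) hxy) h)
    refine ⟨hcol, S.comp_eq_comp hcT (S.mono (subset_insert _ _) hcl) hc4 hD ?_ (by tauto)⟩
    rw [insert_inter_of_notMem hv, inter_eq_left.2 hT, hT3]
  refine ⟨h1, fun t ht => ?_⟩
  obtain ⟨T, hT1, hT2, hT3⟩ := exists_subsuperset_card_eq (s := {t}) (t := D) (n := 3)
    (by simpa using ht) (by simp) (by omega)
  have htT : t ∈ T := hT1 (by simp)
  have hvt : v ≠ t := fun h => hv (h ▸ ht)
  obtain ⟨u, hu, hut⟩ := exists_mem_ne (by omega : 1 < #T) t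
  have hnp : ¬ S.pcol {v, t} := by
    intro hp
    have hs : ({v, t} : Finset V) ⊆ insert v T := by simp [insert_subset_iff, htT]
    have hcT : S.IsClique (insert v T) := S.mono (insert_subset_insert _ hT2) hcl
    have h2 := S.comp_eq_pcomp hcT
      (by rw [card_insert_of_notMem (fun h => hv (hT2 h)), hT3]) hs (card_pair hvt)
      (by have := (h1 T hT2 hT3).1; tauto)
    rw [hR v t hvt (S.mono hs hcT) hp, (h1 T hT2 hT3).2] at h2
    exact hDR h2
  refine ((hDb t ht u (hT2 hu) (Ne.symm hut)).trans_of_not_pcol (Ne.symm hvt)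
    (fun h => hv (h ▸ hT2 hu)) (S.mono (by simp [insert_subset_iff, ht, hT2 hu]) hcl) ?_).symm
  rwa [pair_comm]

/-- A red edge cannot have a vertex, pair and triple, in increasing order, none of which forms a
blue edge with a clique `D` of blue pairs. -/
theorem false_of_forall_not_blueEdge {R B : Λ} {D e : Finset V} {x y z : V} (hD : #D = 4)
    (hDe : Disjoint D e) (he : S.RedEdge R e) (hx : x ∈ e) (hy : y ∈ e) (hz : z ∈ e) (hxy : x ≠ y)
    (hxz : x ≠ z) (hyz : y ≠ z) (hcl : S.IsClique (D ∪ e))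
    (hR : ∀ x y, x ≠ y → S.IsClique {x, y} → S.pcol {x, y} → S.pcomp {x, y} = R)
    (hDb : ∀ x ∈ D, ∀ y ∈ D, x ≠ y → S.BluePair B x y) (hDc : S.col D) (hDR : S.comp D ≠ R)
    (h1 : ∀ T ⊆ D, #T ≤ 3 → ¬ S.BlueEdge B ({x} ∪ T))
    (h2 : ∀ T ⊆ D, #T ≤ 3 → ¬ S.BlueEdge B ({x, y} ∪ T))
    (h3 : ∀ T ⊆ D, #T ≤ 3 → ¬ S.BlueEdge B ({x, y, z} ∪ T)) : False := by
  -- For `p`, `q`, `r` in `D`, the sets `D`, `xpqr`, `xypq`, `xyzp`, `e` form a chain of red cliques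
  -- in which consecutive ones share three vertices, so `D` would have label `R`.
  have hnD : ∀ v ∈ e, v ∉ D := fun v hv hvD => Finset.disjoint_left.1 hDe hvD hv
  obtain ⟨T, hT, hT3⟩ := exists_subset_card_eq (by omega : 3 ≤ #D)
  obtain ⟨p, q, r, hpq, hpr, hqr, rfl⟩ := card_eq_three.1 hT3
  have hp : p ∈ D := hT (by simp)
  have hq : q ∈ D := hT (by simp)
  have hr : r ∈ D := hT (by simp)
  have hne : ∀ v ∈ e, ∀ d ∈ D, v ≠ d := fun v hv d hd h => hnD v hv (h ▸ hd)
  have xp := hne x hx p hp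
  have xq := hne x hx q hq
  have xr := hne x hx r hr
  have yp := hne y hy p hp
  have yq := hne y hy q hq
  have yr := hne y hy r hr
  have zp := hne z hz p hp
  obtain ⟨hX1, hbp⟩ := bluePair_of_forall_not_blueEdge hD (hnD x hx)
    (S.mono (insert_subset (mem_union_right _ hx) subset_union_left) hcl) hR hDb hDc hDR
    (fun T hT hT3 h => h1 T hT hT3.le (by rwa [← insert_eq]))
  obtain ⟨hc1, he1⟩ := hX1 _ hT hT3
  have hclq : ∀ {Y : Finset V}, Y ⊆ D ∪ e → S.IsClique Y := fun h => S.mono h hcl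
  have mx : x ∈ D ∪ e := mem_union_right _ hx
  have my : y ∈ D ∪ e := mem_union_right _ hy
  have mz : z ∈ D ∪ e := mem_union_right _ hz
  have mp : p ∈ D ∪ e := mem_union_left _ hp
  have mq : q ∈ D ∪ e := mem_union_left _ hq
  have mr : r ∈ D ∪ e := mem_union_left _ hr
  have sub4 : ∀ {a b c d : V}, a ∈ D ∪ e → b ∈ D ∪ e → c ∈ D ∪ e → d ∈ D ∪ e →
      ({a, b, c, d} : Finset V) ⊆ D ∪ e := fun ha hb hc hd =>
    insert_subset ha (insert_subset hb (insert_subset hc (singleton_subset_iff.2 hd)))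
  have hY2 : ({y, x, p, q} : Finset V) ⊆ D ∪ e := sub4 my mx mp mq
  have hY3 : ({z, y, x, p} : Finset V) ⊆ D ∪ e := sub4 mz my mx mp
  have h24 : #({y, x, p, q} : Finset V) = 4 :=
    card_insert_insert_pair hxy.symm yp yq xp xq hpq
  have h34 : #({z, y, x, p} : Finset V) = 4 :=
    card_insert_insert_pair hyz.symm hxz.symm zp hxy.symm yp xp
  have hc2 : S.col {y, x, p, q} := by
    by_contra h
    refine h2 {p, q} (by simp [insert_subset_iff, hp, hq]) (by rw [card_pair hpq]; norm_num) ?_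
    have := blueEdge_of_bluePair (c := p) (d := q) (hclq hY2) h24 (by simp) (by simp)
      (hDb p hp q hq hpq) h
    rwa [insert_union, singleton_union, Finset.insert_comm]
  -- This set has only one vertex in `D`; the blue pair it needs is `{x, p}`, available because
  -- `{x}` has no completion.
  have hc3 : S.col {z, y, x, p} := by
    by_contra h
    refine h3 {p} (by simpa using hp) (by simp) ?_
    have := blueEdge_of_bluePair (c := x) (d := p) (hclq hY3) h34 (by simp) (by simp)
      (hbp p hp) h
    have hs : ({x, y, z} : Finset V) ∪ {p} = {z, y, x, p} := by
      rw [insert_union, insert_union, singleton_union, Finset.insert_comm y z,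
        Finset.insert_comm x z, Finset.insert_comm x y]
    rwa [hs]
  have e12 : S.comp {y, x, p, q} = S.comp {x, p, q, r} := by
    have := comp_insert_eq (S := S) (T := {x, p, q}) (x := y) (y := r)
      (card_eq_three.2 ⟨x, p, q, xp, xq, hpq, rfl⟩) (by simp [yp, yq, Ne.symm hxy])
      (by simp [Ne.symm xr, Ne.symm hpr, Ne.symm hqr]) (hclq hY2)
      (hclq (sub4 mr mx mp mq))
    rw [insert_triple_rotate x p q r] at this
    exact this (iff_of_true hc2 hc1)
  have e23 : S.comp {z, y, x, p} = S.comp {y, x, p, q} := by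
    have := comp_insert_eq (S := S) (T := {y, x, p}) (x := z) (y := q)
      (card_eq_three.2 ⟨y, x, p, Ne.symm hxy, yp, xp, rfl⟩)
      (by simp [zp, Ne.symm hxz, Ne.symm hyz])
      (by simp [Ne.symm xq, Ne.symm yq, Ne.symm hpq]) (hclq hY3)
      (hclq (sub4 mq my mx mp))
    rw [insert_triple_rotate y x p q] at this
    exact this (iff_of_true hc3 hc2)
  have h4 : #({z, y, x} : Finset V) = 3 := card_eq_three.2 ⟨z, y, x, Ne.symm hyz, Ne.symm hxz,
    Ne.symm hxy, rfl⟩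
  have h5 : ({z, y, x} : Finset V) ⊆ e := by simp [insert_subset_iff, hx, hy, hz]
  have e3 : S.comp {z, y, x, p} = S.comp e := by
    refine S.comp_eq_comp (hclq hY3) he.2.1 h34 he.1 ?_ (by have := he.2.2.1; tauto)
    have : ({z, y, x, p} : Finset V) ∩ e = {z, y, x} := by
      ext v
      simp only [mem_inter, mem_insert, mem_singleton]
      constructor
      · rintro ⟨rfl | rfl | rfl | rfl, hv⟩
        · simp
        · simp
        · simp
        · exact absurd hp (hnD _ hv)
      · intro h
        exact ⟨by rcases h with h | h | h <;> simp [h], h5 (by simpa using h)⟩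
    rw [this, h4]
  exact hDR (by rw [← he1, ← e12, ← e23, e3, he.2.2.2])

/-- A red edge can be replaced by blue edges in such a way that at most one of its vertices is lost,
which forms blue pairs with most of `L`. -/
theorem exists_replacement [Fintype V] {b : ℝ} (hS : S.Extends b) (hb : 1 ≤ b) {R B : Λ}
    (hR : ∀ x y, x ≠ y → S.IsClique {x, y} → S.pcol {x, y} → S.pcomp {x, y} = R) {L e : Finset V}
    (hfree : ∀ X ⊆ L, ¬ S.RedEdge R X ∧ ¬ S.BlueEdge B X)
    (hbad : ∀ N ⊆ L ×ˢ L, (∀ p ∈ N, ¬ S.BluePair B p.1 p.2) →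
      (#N : ℝ) ≤ 2 ^ 11 * b * Fintype.card V) (hL : 2 ^ 13 * b < #L)
    (hL2 : 2 ^ 14 * b * Fintype.card V < (#L : ℝ) ^ 2) (he : S.RedEdge R e) (heL : Disjoint e L) :
    ∃ N : Finset (Finset V), N.Nonempty ∧ (N : Set (Finset V)).PairwiseDisjoint id ∧
      (∀ f ∈ N, S.BlueEdge B f ∧ f ⊆ e ∪ L) ∧
      ∀ y ∈ e, y ∉ coveredVertices N → (∀ z ∈ e, z ∉ coveredVertices N → z = y) ∧
        ∀ T ⊆ L, (∀ t ∈ T, ¬ S.BluePair B y t) → (#T : ℝ) ≤ 2 ^ 7 * b := by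
  classical
  obtain ⟨A, hAF, P, L', hL', hcard, hA, hAd, hun⟩ :=
    exists_greedy_completion (S.BlueEdge B) e.powerset L
  have heL' : Disjoint e L' := heL.mono_right hL'
  rw [card_powerset, he.card] at hcard
  have hcardR : (#L : ℝ) ≤ #L' + 48 := by exact_mod_cast hcard
  have hL'1 : 2 ^ 12 * b ≤ #L' := by linarith
  -- Otherwise each pair of `L'` is bad or fails to extend `e`, giving at most `(2 ^ 11 + 2 ^ 6) * b
  -- * n` pairs, where `n` is the number of vertices, while `#L' ^ 2 ≥ #L ^ 2 / 4 > 2 ^ 12 * b * n`.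
  obtain ⟨u, hu, v, hv, huv, huvc⟩ : ∃ u ∈ L', ∃ v ∈ L', S.BluePair B u v ∧
      S.IsClique (insert u (insert v e)) := by
    by_contra! hcon
    let N1 := (L' ×ˢ L').filter fun p => ¬ S.BluePair B p.1 p.2
    let N2 := (L' ×ˢ L').filter fun p => S.BluePair B p.1 p.2
    have h1 := hbad N1 ((filter_subset _ _).trans (product_subset_product hL' hL'))
      (by simp [N1])
    have h2 := card_not_isClique_pair_le hS he.2.1 N2 (by
      intro p hp
      simp only [N2, mem_filter, mem_product] at hp
      exact hcon _ hp.1.1 _ hp.1.2 hp.2)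
    rw [he.card] at h2
    have h3 : #N2 + #N1 = #L' * #L' := by
      rw [← card_product]; exact card_filter_add_card_filter_not _
    have h4 : (#N2 : ℝ) + #N1 = #L' * #L' := by exact_mod_cast h3
    have h5 : (#L : ℝ) ≤ 2 * #L' := by linarith
    have h6 : (#L : ℝ) ^ 2 ≤ (2 * #L') ^ 2 := by gcongr
    have h7 : (0 : ℝ) ≤ b * Fintype.card V := by positivity
    have h8 : (#L : ℝ) ^ 2 ≤ 4 * (#N2 + #N1) := by rw [h4]; linarith
    norm_num at h1 h2 hL2
    linarith
  have huve : u ∉ e ∧ v ∉ e := ⟨fun h => Finset.disjoint_left.1 heL' h hu,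
    fun h => Finset.disjoint_left.1 heL' h hv⟩
  have hne := huv.1
  have hfreeL' : ∀ D ⊆ L', #D = 4 → u ∈ D → v ∈ D → S.IsClique D →
      (∀ x ∈ D, ∀ y ∈ D, x ≠ y → S.BluePair B x y) ∧ S.col D ∧ S.comp D ≠ R := by
    intro D hD hD4 huD hvD hcl
    have hf := fun X (hX : X ⊆ D) => hfree X (hX.trans (hD.trans hL'))
    exact ⟨fun x hx y hy hxy => bluePair_of_free hcl hD4.ge hR hf huD hvD huv hx hy hxy,
      col_of_free hcl hD4.ge hR hf huD hvD huv Subset.rfl hD4⟩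
  have hunav : ∀ X ⊆ e, X ∉ A → ∀ T ⊆ L', #T ≤ 3 → ¬ S.BlueEdge B (X ∪ T) := fun X hX =>
    hun X (mem_powerset.2 hX)
  have hL13 : ∀ {k : ℕ} {C : Finset V}, S.IsClique C → #C + k ≤ 12 →
      ∃ T ⊆ L', #T = k ∧ Disjoint T C ∧ S.IsClique (T ∪ C) := fun hC hk =>
    exists_extend hS hb hC hk hL'1
  -- A vertex `t` of `L'` extending `e ∪ {u, v}` lies with `u`, `v` in a `4`-clique of blue pairs,
  -- and the uncompletable `y` then forms a blue pair with `t`. The exceptions are at most `2 ^ 6 *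
  -- b`, plus `48` reserved vertices and `u`, `v`.
  have hsingle : ∀ y ∈ e, {y} ∉ A → ∀ T ⊆ L, (∀ t ∈ T, ¬ S.BluePair B y t) →
      (#T : ℝ) ≤ 2 ^ 7 * b := by
    intro y hy hyA T hTL hT
    let N := (T ∩ L') \ {u, v}
    have h1 : #T ≤ #N + 50 := by
      have e1 := card_le_card_sdiff_add_card (s := T ∩ L') (t := {u, v})
      have e2 := card_sdiff_add_card_inter T L'
      have e3 : #(T \ L') ≤ #(L \ L') := card_le_card (sdiff_subset_sdiff hTL Subset.rfl)
      have e4 := card_sdiff_add_card_eq_card hL'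
      rw [card_pair hne] at e1
      change #(T ∩ L') ≤ #N + 2 at e1
      omega
    have h2 := hS.2 _ N huvc ?_
    · have h3 : #(insert u (insert v e)) = 6 := by
        rw [card_insert_of_notMem, card_insert_of_notMem huve.2, he.card]
        simp [hne, huve.1]
      rw [h3] at h2
      have h4 : (#T : ℝ) ≤ #N + 50 := by exact_mod_cast h1
      linarith
    · intro t ht hcl
      simp only [N, Finset.mem_sdiff, mem_inter, mem_insert, mem_singleton, not_or] at ht
      obtain ⟨⟨htT, htL'⟩, htu, htv⟩ := ht
      have hte : t ∉ e := fun h => Finset.disjoint_left.1 heL' h htL'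
      obtain ⟨T', hT'L, hT'1, hT'd, hT'c⟩ := hL13 (k := 1) hcl (by
        have e1 := card_insert_le t (insert u (insert v e))
        have e2 := card_insert_le u (insert v e)
        have e3 := card_insert_le v e
        have := he.card
        omega)
      obtain ⟨s, rfl⟩ := card_eq_one.1 hT'1
      simp only [disjoint_singleton_left, mem_insert, not_or] at hT'd
      have hD4 : #({s, t, u, v} : Finset V) = 4 := by
        rw [card_insert_of_notMem, card_insert_of_notMem, card_pair hne] <;> simp [*]
      have hDL : ({s, t, u, v} : Finset V) ⊆ L' := by
        simp only [singleton_subset_iff] at hT'L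
        simp [insert_subset_iff, *]
      have hDc : S.IsClique {s, t, u, v} := S.mono (by
        intro x; simp only [mem_insert, mem_singleton, mem_union]; tauto) hT'c
      obtain ⟨g1, g2, g3⟩ := hfreeL' _ hDL hD4 (by simp) (by simp) hDc
      refine hT t htT ((bluePair_of_forall_not_blueEdge hD4 ?_ ?_ hR g1 g2 g3 ?_).2 t (by simp))
      · exact fun h => Finset.disjoint_left.1 heL' hy (hDL h)
      · refine S.mono ?_ hT'c
        intro x
        simp only [mem_insert, mem_singleton, mem_union]
        rintro (rfl | h)
        · tauto
        · tauto
      · intro U hU hU3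
        have := hunav {y} (by simpa using hy) hyA U (hU.trans hDL) hU3.le
        rwa [← insert_eq] at this
  have htriple : ∀ x ∈ e, ∀ y ∈ e, ∀ z ∈ e, x ≠ y → x ≠ z → y ≠ z → {x} ∉ A → {x, y} ∉ A →
      {x, y, z} ∈ A := by
    intro x hx y hy z hz hxy hxz hyz hxA hxyA
    by_contra hxyzA
    obtain ⟨T', hT'L, hT'2, hT'd, hT'c⟩ := hL13 (k := 2) huvc (by
      have e2 := card_insert_le u (insert v e)
      have e3 := card_insert_le v e
      have := he.card
      omega)
    set D := T' ∪ {u, v} with hD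
    have hD4 : #D = 4 := by
      rw [hD, card_union_of_disjoint, hT'2, card_pair hne]
      exact hT'd.mono_right (by simp [insert_subset_iff])
    have hDL : D ⊆ L' := union_subset hT'L (by simp [insert_subset_iff, hu, hv])
    have hDe : S.IsClique (D ∪ e) := S.mono (by intro w; simp only [hD, mem_insert, mem_singleton, mem_union]; tauto) hT'c
    obtain ⟨g1, g2, g3⟩ := hfreeL' D hDL hD4 (by simp [hD]) (by simp [hD])
      (S.mono subset_union_left hDe)
    exact false_of_forall_not_blueEdge hD4 (heL'.symm.mono_left hDL) he hx hy hz hxy hxz hyz hDe hR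
      g1 g2 g3 (fun T hT => hunav _ (by simpa using hx) hxA T (hT.trans hDL))
      (fun T hT => hunav _ (by simp [insert_subset_iff, hx, hy]) hxyA T (hT.trans hDL))
      (fun T hT => hunav _ (by simp [insert_subset_iff, hx, hy, hz]) hxyzA T (hT.trans hDL))
  -- It remains to choose disjoint completable subsets of `e` missing at most one vertex, and that
  -- vertex must not be completable alone.
  have finish : ∀ Q ⊆ A, Q.Nonempty → (Q : Set (Finset V)).PairwiseDisjoint id →
      (∀ y ∈ e, y ∉ coveredVertices Q → {y} ∉ A ∧ ∀ z ∈ e, z ∉ coveredVertices Q → z = y) →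
      ∃ N : Finset (Finset V), N.Nonempty ∧ (N : Set (Finset V)).PairwiseDisjoint id ∧
        (∀ f ∈ N, S.BlueEdge B f ∧ f ⊆ e ∪ L) ∧
        ∀ y ∈ e, y ∉ coveredVertices N → (∀ z ∈ e, z ∉ coveredVertices N → z = y) ∧
          ∀ T ⊆ L, (∀ t ∈ T, ¬ S.BluePair B y t) → (#T : ℝ) ≤ 2 ^ 7 * b := by
    intro Q hQA hQ hQd hQy
    have hcov : ∀ y ∈ e, y ∉ coveredVertices (Q.image fun X => X ∪ P X) →
        y ∉ coveredVertices Q := by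
      intro y _ h hyQ
      simp only [coveredVertices, mem_biUnion, mem_image, id] at h hyQ
      obtain ⟨X, hX, hyX⟩ := hyQ
      exact h ⟨_, ⟨X, hX, rfl⟩, mem_union_left _ hyX⟩
    have hXe : ∀ X ∈ Q, X ⊆ e := fun X hX => mem_powerset.1 (hAF (hQA hX))
    refine ⟨Q.image fun X => X ∪ P X, hQ.image _, ?_, ?_, fun y hy hyc => ⟨fun z hz hzc => ?_, ?_⟩⟩
    · intro f hf g hg hfg
      simp only [coe_image, Set.mem_image, mem_coe] at hf hg
      obtain ⟨X, hX, rfl⟩ := hf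
      obtain ⟨Y, hY, rfl⟩ := hg
      have hXY : X ≠ Y := fun h => hfg (h ▸ rfl)
      have hPX := (hA X (hQA hX)).1
      have hPY := (hA Y (hQA hY)).1
      simp only [Function.onFun, id, disjoint_union_left, disjoint_union_right]
      exact ⟨⟨hQd hX hY hXY, (heL.mono (hXe Y hY) hPX).symm⟩, heL.mono (hXe X hX) hPY,
        hAd (hQA hX) (hQA hY) hXY⟩
    · intro f hf
      obtain ⟨X, hX, rfl⟩ := mem_image.1 hf
      have := hA X (hQA hX)
      exact ⟨this.2.2.2, union_subset_union (hXe X hX) this.1⟩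
    · exact (hQy y hy (hcov y hy hyc)).2 z hz (hcov z hz hzc)
    · exact hsingle y hy (hQy y hy (hcov y hy hyc)).1
  -- With at most one uncompletable vertex, singletons suffice. Otherwise two such vertices `x`, `y`
  -- are fixed and grouped with the others.
  by_cases hY : #(e.filter fun y => {y} ∉ A) ≤ 1
  · refine finish ((e.filter fun y => {y} ∈ A).image singleton) ?_ ?_ ?_ ?_
    · intro X hX
      obtain ⟨y, hy, rfl⟩ := mem_image.1 hX
      exact (mem_filter.1 hy).2
    · have : #(e.filter fun y => {y} ∈ A) + #(e.filter fun y => {y} ∉ A) = #e :=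
        card_filter_add_card_filter_not _
      rw [he.card] at this
      exact (card_pos.1 (by omega)).image _
    · intro X hX Y hY hXY
      simp only [coe_image, Set.mem_image] at hX hY
      obtain ⟨x, -, rfl⟩ := hX
      obtain ⟨y, -, rfl⟩ := hY
      simp only [Function.onFun, id, disjoint_singleton]
      exact fun h => hXY (h ▸ rfl)
    · have hc : ∀ y ∈ e, y ∉ coveredVertices ((e.filter fun y => {y} ∈ A).image singleton) →
          y ∈ e.filter fun y => {y} ∉ A := by
        intro y hy hyc
        refine mem_filter.2 ⟨hy, fun h => hyc ?_⟩
        exact mem_biUnion.2 ⟨{y}, mem_image.2 ⟨y, mem_filter.2 ⟨hy, h⟩, rfl⟩, by simp⟩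
      exact fun y hy hyc => ⟨(mem_filter.1 (hc y hy hyc)).2, fun z hz hzc =>
        card_le_one.1 hY z (hc z hz hzc) y (hc y hy hyc)⟩
  · obtain ⟨x, hx, y, hy, hxy⟩ := one_lt_card.1 (not_le.1 hY)
    obtain ⟨hx, hxA⟩ := mem_filter.1 hx
    obtain ⟨hy, hyA⟩ := mem_filter.1 hy
    obtain ⟨z, w, hzw, hezw⟩ : ∃ z w, z ≠ w ∧ e \ {x, y} = {z, w} := by
      refine card_eq_two.1 ?_
      rw [card_sdiff_of_subset (by simp [insert_subset_iff, hx, hy]), he.card, card_pair hxy]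
    have hz : z ∈ e \ {x, y} := by rw [hezw]; simp
    have hw : w ∈ e \ {x, y} := by rw [hezw]; simp
    have hmem : ∀ t ∈ e, t = x ∨ t = y ∨ t = z ∨ t = w := by
      intro t ht
      by_cases h : t ∈ ({x, y} : Finset V)
      · simp only [mem_insert, mem_singleton] at h; tauto
      · have : t ∈ ({z, w} : Finset V) := hezw ▸ Finset.mem_sdiff.2 ⟨ht, h⟩
        simp only [mem_insert, mem_singleton] at this; tauto
    simp only [Finset.mem_sdiff, mem_insert, mem_singleton, not_or] at hz hw
    obtain ⟨hz, hzx, hzy⟩ := hz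
    obtain ⟨hw, hwx, hwy⟩ := hw
    have hcv : ∀ (Q : Finset (Finset V)) (t : V), t ∈ coveredVertices Q ↔ ∃ X ∈ Q, t ∈ X := by
      simp [coveredVertices]
    by_cases hxyA : {x, y} ∈ A
    · by_cases hzA : {z} ∈ A
      · by_cases hwA : {w} ∈ A
        · refine finish {{x, y}, {z}, {w}} (by simp [insert_subset_iff, *]) (by simp) ?_ ?_
          · simp [Set.pairwiseDisjoint_insert, *, Ne.symm hzx, Ne.symm hzy, Ne.symm hwx, Ne.symm hwy]
          · intro t ht htc
            rw [hcv] at htc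
            rcases hmem t ht with h | h | h | h <;> first | exact h | exact absurd (by simp [h]) htc
        · refine finish {{x, y}, {z}} (by simp [insert_subset_iff, *]) (by simp) ?_ ?_
          · simp [Set.pairwiseDisjoint_insert, *, Ne.symm hzx, Ne.symm hzy]
          · have key : ∀ t ∈ e, t ∉ coveredVertices {{x, y}, {z}} → t = w := by
              intro t ht htc
              rw [hcv] at htc
              rcases hmem t ht with h | h | h | h <;> first | exact h | exact absurd (by simp [h]) htc
            exact fun t ht htc => ⟨key t ht htc ▸ hwA, fun s hs hsc =>
              (key s hs hsc).trans (key t ht htc).symm⟩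
      · by_cases hwA : {w} ∈ A
        · refine finish {{x, y}, {w}} (by simp [insert_subset_iff, *]) (by simp) ?_ ?_
          · simp [Set.pairwiseDisjoint_insert, *, Ne.symm hwx, Ne.symm hwy]
          · have key : ∀ t ∈ e, t ∉ coveredVertices {{x, y}, {w}} → t = z := by
              intro t ht htc
              rw [hcv] at htc
              rcases hmem t ht with h | h | h | h <;> first | exact h | exact absurd (by simp [h]) htc
            exact fun t ht htc => ⟨key t ht htc ▸ hzA, fun s hs hsc =>
              (key s hs hsc).trans (key t ht htc).symm⟩
        · by_cases hzwA : {z, w} ∈ A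
          · refine finish {{x, y}, {z, w}} (by simp [insert_subset_iff, *]) (by simp) ?_ ?_
            · simp [Set.pairwiseDisjoint_insert, *, Ne.symm hzx, Ne.symm hzy, Ne.symm hwx,
                Ne.symm hwy]
            · intro t ht htc
              rw [hcv] at htc
              rcases hmem t ht with h | h | h | h <;> first | exact h | exact absurd (by simp [h]) htc
          -- Here `z`, `w` and their pair are all uncompletable, so the triple with `x` is
          -- completable, leaving only the uncompletable vertex `y`.
          · have hzwx := htriple z hz w hw x hx hzw hzx hwx hzA hzwA
            refine finish {{z, w, x}} (by simp [*]) (by simp) (by simp) ?_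
            have key : ∀ t ∈ e, t ∉ coveredVertices {{z, w, x}} → t = y := by
              intro t ht htc
              rw [hcv] at htc
              rcases hmem t ht with h | h | h | h <;> first | exact h | exact absurd (by simp [h]) htc
            exact fun t ht htc => ⟨key t ht htc ▸ hyA, fun s hs hsc =>
              (key s hs hsc).trans (key t ht htc).symm⟩
    · have hxyz := htriple x hx y hy z hz hxy (Ne.symm hzx) (Ne.symm hzy) hxA hxyA
      by_cases hwA : {w} ∈ A
      · refine finish {{x, y, z}, {w}} (by simp [insert_subset_iff, *]) (by simp) ?_ ?_
        · simp [Set.pairwiseDisjoint_insert, *, Ne.symm hwx, Ne.symm hwy]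
        · intro t ht htc
          rw [hcv] at htc
          rcases hmem t ht with h | h | h | h <;> first | exact h | exact absurd (by simp [h]) htc
      · refine finish {{x, y, z}} (by simp [*]) (by simp) (by simp) ?_
        have key : ∀ t ∈ e, t ∉ coveredVertices {{x, y, z}} → t = w := by
          intro t ht htc
          rw [hcv] at htc
          rcases hmem t ht with h | h | h | h <;> first | exact h | exact absurd (by simp [h]) htc
        exact fun t ht htc => ⟨key t ht htc ▸ hwA, fun s hs hsc =>
          (key s hs hsc).trans (key t ht htc).symm⟩

end

end CliqueSystem

/-! ### The potential argument and the abstract covering theorem -/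

namespace CliqueSystem

section
variable {V Λ : Type*} [DecidableEq V] {S : CliqueSystem V Λ}

/-- An extremal argument: a minimiser of `Φ` leaves no edge of either label and contains no red
edge, so `hasCover_of_forall_blueEdge` applies to it. -/
theorem hasCover_of_red [Fintype V] {b m : ℝ} (hS : S.Extends b) (hb : 1 ≤ b) {R : Λ}
    (hR : ∀ x y, x ≠ y → S.IsClique {x, y} → S.pcol {x, y} → S.pcomp {x, y} = R)
    (hm : 2 ^ 13 * b ≤ m) (hm2 : 2 ^ 14 * b * Fintype.card V ≤ m ^ 2) : S.HasCover m := by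
  classical
  by_contra hno
  obtain ⟨B, M₀, hM₀d, hM₀, hM₀b⟩ := (hasCover_or_exists_matching hS hb hR
    (by linarith : 2 ^ 12 * b ≤ m)).resolve_left hno
  let bad : Finset (Finset V) → Finset (V × V) := fun M => univ.filter fun p =>
    p.1 ∉ coveredVertices M ∧ p.2 ∉ coveredVertices M ∧ ¬ S.BluePair B p.1 p.2
  -- Exchanging a red edge creates at most `2 ^ 8 * b + 1` bad pairs; the weight `2 ^ 9 * b` makes
  -- the loss of one red edge outweigh them.
  let Φ : Finset (Finset V) → ℝ := fun M =>
    #(bad M) + 2 ^ 9 * b * (#(M.filter S.col) + #(coveredVertices M)ᶜ)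
  let F : Finset (Finset (Finset V)) := univ.filter fun M =>
    (M : Set (Finset V)).PairwiseDisjoint id ∧ ∀ e ∈ M, S.RedEdge R e ∨ S.BlueEdge B e
  obtain ⟨M, hMF, hmin⟩ := F.exists_min_image Φ ⟨M₀, mem_filter.2 ⟨mem_univ _, hM₀d, hM₀⟩⟩
  obtain ⟨hMd, hM⟩ := (mem_filter.1 hMF).2
  have hmin : ∀ M' : Finset (Finset V), (M' : Set (Finset V)).PairwiseDisjoint id →
      (∀ e ∈ M', S.RedEdge R e ∨ S.BlueEdge B e) → Φ M ≤ Φ M' := fun M' h1 h2 =>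
    hmin M' (mem_filter.2 ⟨mem_univ _, h1, h2⟩)
  have hcard4 : ∀ M' : Finset (Finset V), (∀ e ∈ M', S.RedEdge R e ∨ S.BlueEdge B e) →
      ∀ e ∈ M', #e = 4 := fun M' h e he => (h e he).elim (fun h => h.1) (fun h => h.1)
  have hcompl : ∀ M' : Finset (Finset V), (M' : Set (Finset V)).PairwiseDisjoint id →
      (∀ e ∈ M', S.RedEdge R e ∨ S.BlueEdge B e) →
      #(coveredVertices M')ᶜ + #M' * 4 = Fintype.card V := by
    intro M' h1 h2
    rw [← card_coveredVertices h1 (hcard4 M' h2), card_compl_add_card]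
  set L := (coveredVertices M)ᶜ with hL
  set n := Fintype.card V
  have hb0 : 0 ≤ b := by linarith
  have hLm : m < #L := by
    by_contra! hcon
    exact hno ⟨M, R, B, hMd, hM, hcon⟩
  have hbadM : (#(bad M) : ℝ) ≤ 2 ^ 11 * b * n := by
    have h1 := hmin M₀ hM₀d hM₀
    have h2 : (#(bad M₀) : ℝ) ≤ 2 ^ 7 * b * n := hM₀b _ fun x y h => by
      simpa only [bad, mem_filter, mem_univ, true_and] using h
    have h3 := hcompl M₀ hM₀d hM₀
    have h4 : #(M₀.filter S.col) ≤ #M₀ := card_filter_le _ _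
    have h5 : (#(M₀.filter S.col) : ℝ) + #(coveredVertices M₀)ᶜ ≤ n := by
      exact_mod_cast (by omega : #(M₀.filter S.col) + #(coveredVertices M₀)ᶜ ≤ n)
    have h6 : 2 ^ 9 * b * ((#(M₀.filter S.col) : ℝ) + #(coveredVertices M₀)ᶜ) ≤
        2 ^ 9 * b * n := by gcongr
    have h7 : (0 : ℝ) ≤ 2 ^ 9 * b * ((#(M.filter S.col) : ℝ) + #(coveredVertices M)ᶜ) := by
      positivity
    have h8 : (0 : ℝ) ≤ b * n := by positivity
    simp only [Φ] at h1
    linarith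
  have hbad : ∀ N ⊆ L ×ˢ L, (∀ p ∈ N, ¬ S.BluePair B p.1 p.2) → (#N : ℝ) ≤ 2 ^ 11 * b * n := by
    intro N hN hN'
    refine le_trans ?_ hbadM
    refine Nat.cast_le.2 (card_le_card fun p hp => ?_)
    have := mem_product.1 (hN hp)
    rw [hL, mem_compl, mem_compl] at this
    exact mem_filter.2 ⟨mem_univ _, this.1, this.2, hN' p hp⟩
  -- Adding a leftover edge covers four more vertices and adds at most one red edge, so the
  -- potential would drop.
  have hfree' : ∀ X ⊆ L, S.RedEdge R X ∨ S.BlueEdge B X → False := by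
    intro X hXL hX
    have hXd : ∀ e ∈ M, Disjoint X e := by
      intro e he
      refine Finset.disjoint_left.2 fun x hx hxe => ?_
      have := hXL hx
      rw [hL, mem_compl] at this
      exact this (mem_biUnion.2 ⟨e, he, hxe⟩)
    have hX4 : #X = 4 := hX.elim (fun h => h.1) (fun h => h.1)
    have hXM : X ∉ M := by
      intro h
      have := hXd X h
      rw [disjoint_self_iff_empty] at this
      simp [this] at hX4
    have hd : ((insert X M : Finset (Finset V)) : Set (Finset V)).PairwiseDisjoint id := by
      rw [coe_insert, Set.pairwiseDisjoint_insert]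
      exact ⟨hMd, fun e he _ => hXd e he⟩
    have hE : ∀ e ∈ insert X M, S.RedEdge R e ∨ S.BlueEdge B e := by
      intro e he
      rcases mem_insert.1 he with rfl | he
      · exact hX
      · exact hM e he
    have h1 := hmin _ hd hE
    have h2 := hcompl _ hd hE
    have h3 := hcompl M hMd hM
    rw [card_insert_of_notMem hXM] at h2
    have h4 : #((insert X M).filter S.col) ≤ #(M.filter S.col) + 1 := by
      rw [filter_insert]
      split_ifs
      · exact card_insert_le _ _
      · omega
    have h5 : #(bad (insert X M)) ≤ #(bad M) := by
      refine card_le_card fun p hp => ?_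
      obtain ⟨-, g1, g2, g3⟩ := mem_filter.1 hp
      have hsub : coveredVertices M ⊆ coveredVertices (insert X M) :=
        biUnion_subset_biUnion_of_subset_left _ (subset_insert _ _)
      exact mem_filter.2 ⟨mem_univ _, fun h => g1 (hsub h), fun h => g2 (hsub h), g3⟩
    have h6 : (#((insert X M).filter S.col) : ℝ) + #(coveredVertices (insert X M))ᶜ + 3 ≤
        #(M.filter S.col) + #(coveredVertices M)ᶜ := by
      exact_mod_cast (by omega : #((insert X M).filter S.col) + #(coveredVertices (insert X M))ᶜ + 3
        ≤ #(M.filter S.col) + #(coveredVertices M)ᶜ)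
    have h7 : (#(bad (insert X M)) : ℝ) ≤ #(bad M) := by exact_mod_cast h5
    simp only [Φ] at h1
    have h8 : 2 ^ 9 * b * ((#((insert X M).filter S.col) : ℝ) + #(coveredVertices (insert X M))ᶜ + 3)
        ≤ 2 ^ 9 * b * (#(M.filter S.col) + #(coveredVertices M)ᶜ) := by gcongr
    linarith
  have hfree : ∀ X ⊆ L, ¬ S.RedEdge R X ∧ ¬ S.BlueEdge B X := fun X hX =>
    ⟨fun h => hfree' X hX (Or.inl h), fun h => hfree' X hX (Or.inr h)⟩
  have hm0 : 0 ≤ m := le_trans (by positivity) hm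
  have hLm2 : m ^ 2 < (#L : ℝ) ^ 2 := by gcongr
  obtain ⟨u, hu, v, hv, huv⟩ : ∃ u ∈ L, ∃ v ∈ L, S.BluePair B u v := by
    by_contra! hcon
    have h1 := hbad (L ×ˢ L) Subset.rfl fun p hp =>
      hcon _ (mem_product.1 hp).1 _ (mem_product.1 hp).2
    rw [card_product] at h1
    push_cast at h1
    have h8 : (0 : ℝ) ≤ b * n := by positivity
    linarith
  refine hno (hasCover_of_forall_blueEdge hS hb hR (by linarith) hMd (fun e he => ?_) hL hfree hu hv
    huv)
  refine (hM e he).resolve_left fun hred => ?_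
  have heL : Disjoint e L := by
    refine Finset.disjoint_left.2 fun x hx hxL => ?_
    rw [hL, mem_compl] at hxL
    exact hxL (mem_biUnion.2 ⟨e, he, hx⟩)
  obtain ⟨N, hN, hNd, hNe, hNy⟩ := exists_replacement hS hb hR hfree hbad (by linarith)
    (by linarith) hred heL
  have hNdis : ∀ f ∈ M.erase e, ∀ g ∈ N, Disjoint f g := by
    intro f hf g hg
    obtain ⟨hfe, hf⟩ := mem_erase.1 hf
    refine Disjoint.mono_right (hNe g hg).2 (disjoint_union_right.2 ⟨hMd hf he hfe, ?_⟩)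
    refine Finset.disjoint_left.2 fun x hx hxL => ?_
    rw [hL, mem_compl] at hxL
    exact hxL (mem_biUnion.2 ⟨f, hf, hx⟩)
  have hMN : Disjoint (M.erase e) N := by
    refine Finset.disjoint_left.2 fun f hf hfN => ?_
    have h1 := hNdis f hf f hfN
    rw [disjoint_self_iff_empty] at h1
    have := (hNe f hfN).1.1
    simp [h1] at this
  have hd : ((M.erase e ∪ N : Finset (Finset V)) : Set (Finset V)).PairwiseDisjoint id := by
    rw [coe_union, Set.pairwiseDisjoint_union]
    exact ⟨hMd.subset (by exact_mod_cast erase_subset _ _), hNd, fun f hf g hg _ => hNdis f hf g hg⟩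
  have hE : ∀ f ∈ M.erase e ∪ N, S.RedEdge R f ∨ S.BlueEdge B f := by
    intro f hf
    rcases mem_union.1 hf with h | h
    · exact hM f (mem_of_mem_erase h)
    · exact Or.inr (hNe f h).1
  have hcov : ∀ x, x ∉ coveredVertices (M.erase e ∪ N) → x ∉ coveredVertices N ∧
      (x ∉ e → x ∉ coveredVertices M) := by
    intro x hx
    simp only [coveredVertices, mem_biUnion, mem_union, mem_erase, id, not_exists, not_and] at hx ⊢
    exact ⟨fun f hf => hx f (Or.inr hf), fun hxe f hf hxf => hx f (Or.inl ⟨fun h => hxe (h ▸ hxf),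
      hf⟩) hxf⟩
  have h1 := hmin _ hd hE
  have h2 := hcompl _ hd hE
  have h3 := hcompl M hMd hM
  have h4 : #M ≤ #(M.erase e ∪ N) := by
    rw [card_union_of_disjoint hMN, card_erase_of_mem he]
    have := card_pos.2 hN
    have := card_pos.2 ⟨e, he⟩
    omega
  have h5 : #((M.erase e ∪ N).filter S.col) + 1 ≤ #(M.filter S.col) := by
    have hem : e ∈ M.filter S.col := mem_filter.2 ⟨he, hred.2.2.1⟩
    have : (M.erase e ∪ N).filter S.col ⊆ (M.filter S.col).erase e := by
      intro f hf
      obtain ⟨hf, hfc⟩ := mem_filter.1 hf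
      rcases mem_union.1 hf with h | h
      · exact mem_erase.2 ⟨(mem_erase.1 h).1, mem_filter.2 ⟨(mem_erase.1 h).2, hfc⟩⟩
      · exact absurd hfc (hNe f h).1.2.2.1
    have := card_le_card this
    rw [card_erase_of_mem hem] at this
    have := card_pos.2 ⟨e, hem⟩
    omega
  -- New bad pairs involve the single lost vertex `y`: the diagonal pair, and two orders of at most
  -- `2 ^ 7 * b` pairs with `L`.
  have h6 : (#(bad (M.erase e ∪ N)) : ℝ) ≤ #(bad M) + 2 ^ 8 * b + 1 := by
    by_cases hy : ∃ y ∈ e, y ∉ coveredVertices N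
    · obtain ⟨y, hye, hyN⟩ := hy
      obtain ⟨huniq, hfew⟩ := hNy y hye hyN
      let T := L.filter fun t => ¬ S.BluePair B y t
      have hT := hfew T (filter_subset _ _) (by simp [T])
      have hsub : bad (M.erase e ∪ N) ⊆ (bad M ∪ {(y, y)}) ∪ ({y} ×ˢ T ∪ T ×ˢ {y}) := by
        rintro ⟨p, q⟩ hpq
        obtain ⟨-, g1, g2, g3⟩ := mem_filter.1 hpq
        have key : ∀ x, x ∉ coveredVertices (M.erase e ∪ N) → x = y ∨ x ∈ L := by
          intro x hx
          by_cases hxe : x ∈ e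
          · exact Or.inl (huniq x hxe (hcov x hx).1)
          · exact Or.inr (mem_compl.2 ((hcov x hx).2 hxe))
        simp only [mem_union, mem_product, mem_singleton, T, mem_filter, Prod.mk.injEq]
        rcases key p g1 with h | h <;> rcases key q g2 with h' | h'
        · exact Or.inl (Or.inr ⟨h, h'⟩)
        · exact Or.inr (Or.inl ⟨h, h', by rw [← h]; exact g3⟩)
        · exact Or.inr (Or.inr ⟨⟨h, by rw [← h']; exact fun hc => g3 hc.symm⟩, h'⟩)
        · exact Or.inl (Or.inl (mem_filter.2 ⟨mem_univ _, mem_compl.1 h, mem_compl.1 h', g3⟩))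
      have e1 := card_le_card hsub
      have e2 := card_union_le (bad M ∪ {(y, y)}) ({y} ×ˢ T ∪ T ×ˢ {y})
      have e3 := card_union_le (bad M) {(y, y)}
      have e4 := card_union_le ({y} ×ˢ T) (T ×ˢ {y})
      rw [card_product, card_product, card_singleton] at e4
      rw [card_singleton] at e3
      have e5 : #(bad (M.erase e ∪ N)) ≤ #(bad M) + 2 * #T + 1 := by omega
      have e6 : (#(bad (M.erase e ∪ N)) : ℝ) ≤ #(bad M) + 2 * #T + 1 := by exact_mod_cast e5
      linarith
    · push Not at hy
      have hsub : bad (M.erase e ∪ N) ⊆ bad M := by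
        rintro p hp
        obtain ⟨-, g1, g2, g3⟩ := mem_filter.1 hp
        exact mem_filter.2 ⟨mem_univ _, (hcov _ g1).2 fun h => (hcov _ g1).1 (hy _ h),
          (hcov _ g2).2 fun h => (hcov _ g2).1 (hy _ h), g3⟩
      have : (#(bad (M.erase e ∪ N)) : ℝ) ≤ #(bad M) := by exact_mod_cast card_le_card hsub
      linarith
  have h7 : (#((M.erase e ∪ N).filter S.col) : ℝ) + #(coveredVertices (M.erase e ∪ N))ᶜ + 1 ≤
      #(M.filter S.col) + #(coveredVertices M)ᶜ := by
    exact_mod_cast (by omega : #((M.erase e ∪ N).filter S.col) +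
      #(coveredVertices (M.erase e ∪ N))ᶜ + 1 ≤ #(M.filter S.col) + #(coveredVertices M)ᶜ)
  have h8 : 2 ^ 9 * b * ((#((M.erase e ∪ N).filter S.col) : ℝ) +
      #(coveredVertices (M.erase e ∪ N))ᶜ + 1) ≤
      2 ^ 9 * b * (#(M.filter S.col) + #(coveredVertices M)ᶜ) := by gcongr
  simp only [Φ] at h1
  linarith

/-- In a clique system with few exceptional extensions, two labels admit an almost perfect
matching. -/
theorem hasCover [Fintype V] {b m : ℝ} (hS : S.Extends b) (hb : 1 ≤ b) (hm : 2 ^ 18 * b ≤ m)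
    (hm2 : 2 ^ 19 * b * Fintype.card V ≤ m ^ 2) : S.HasCover m := by
  have : Nonempty Λ := ⟨S.comp ∅⟩
  obtain ⟨q, hq, hq4, h⟩ := exists_link_pcomp_eq (S := S) hS.1
  have hE := hS.link hb hq
  have h1 : (1 : ℝ) ≤ 2 ^ (#q + 1) := one_le_pow₀ (by norm_num)
  have h2 : (2 : ℝ) ^ (#q + 1) ≤ 2 ^ 5 := pow_le_pow_right₀ (by norm_num) (by omega)
  have hb1 : 1 ≤ 2 ^ (#q + 1) * b := by nlinarith
  have hb2 : 2 ^ (#q + 1) * b ≤ 2 ^ 5 * b := by gcongr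
  have hb3 : 2 ^ (#q + 1) * b * Fintype.card V ≤ 2 ^ 5 * b * Fintype.card V := by gcongr
  -- The link of at most four vertices multiplies `b` by at most `2 ^ 5`, which accounts for the
  -- exponents `18` and `19`.
  refine HasCover.of_link (q := q) ?_
  rcases h with ⟨R, hR⟩ | ⟨B, hB⟩
  · exact hasCover_of_red hE hb1 (R := R) hR (by linarith) (by linarith)
  · exact HasCover.of_swap (hasCover_of_red hE.swap hb1 (R := B) hB (by linarith) (by linarith))

end

end CliqueSystem

/-! ### Counting tools -/

/-- If any two points of `A`, up to few exceptions per point, are related by one of two partial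
equivalence relations, then some class of one of them contains most of `A`. -/
theorem card_not_le_or_card_not_le {V : Type*} {A : Finset V} {r b : V → V → Prop}
    (hr : ∀ {x y z}, r x y → r y z → r x z) (hb : ∀ {x y}, b x y → b y x)
    (hb' : ∀ {x y z}, b x y → b y z → b x z) {d : ℝ}
    (hd : ∀ z ∈ A, ∀ N ⊆ A, (∀ w ∈ N, ¬ r z w ∧ ¬ b z w) → (#N : ℝ) ≤ d) {z : V} (hz : z ∈ A) :
    (∀ N ⊆ A, (∀ w ∈ N, ¬ r z w) → (#N : ℝ) ≤ 2 * d) ∨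
      (∀ N ⊆ A, (∀ w ∈ N, ¬ b z w) → (#N : ℝ) ≤ d) := by
  classical
  refine or_iff_not_imp_left.2 fun h => ?_
  push Not at h
  obtain ⟨Q, hQA, hQ, hQd⟩ := h
  refine fun N hN hNb => hd z hz N hN fun w hw => ⟨fun hrw => ?_, hNb w hw⟩
  -- If `w` is red-related to `z`, no point of `Q` is red-related to `w`. Since `#Q > 2 * d`, some
  -- point of `Q` is blue-related to both, which makes `z` and `w` blue-related after all.
  have hsub : Q ⊆ (Q.filter fun v => ¬ r z v ∧ ¬ b z v) ∪
      Q.filter fun v => ¬ r w v ∧ ¬ b w v := by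
    intro v hv
    rw [mem_union, mem_filter, mem_filter]
    by_contra! hcon
    refine hNb w hw (hb' (hcon.1 hv (hQ v hv)) (hb ?_))
    exact hcon.2 hv fun hc => hQ v hv (hr hrw hc)
  have h1 := (card_le_card hsub).trans (card_union_le _ _)
  have h2 : (#Q : ℝ) ≤ #(Q.filter fun v => ¬ r z v ∧ ¬ b z v) +
      #(Q.filter fun v => ¬ r w v ∧ ¬ b w v) := by exact_mod_cast h1
  have := hd z hz _ ((filter_subset _ Q).trans hQA) fun v hv => (mem_filter.1 hv).2
  have := hd w (hN hw) _ ((filter_subset _ Q).trans hQA) fun v hv => (mem_filter.1 hv).2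
  linarith

/-- If for each pair `x w` few triples `x w y` are bad, then after removing few vertices, each
vertex is in few bad pairs, and for the other pairs `x y` few triples `x w y` are bad. -/
theorem exists_good_pairs {V : Type*} [Fintype V] (Bd : V → V → V → Prop) {D t : ℝ} (ht : 0 < t)
    (hD : ∀ (x w : V) (N : Finset V), (∀ y ∈ N, Bd x w y) → (#N : ℝ) ≤ D) :
    ∃ (Z : Finset V) (P : V → V → Prop), (#Z : ℝ) * t ^ 2 ≤ 2 * D * Fintype.card V ^ 2 ∧
      (∀ x y, P x y → P y x) ∧
      (∀ x ∉ Z, ∀ N : Finset V, (∀ y ∈ N, ¬ P x y) → (#N : ℝ) ≤ t) ∧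
      ∀ x y, P x y → ∀ N : Finset V, (∀ w ∈ N, Bd x w y) → (#N : ℝ) ≤ t := by
  classical
  set n := Fintype.card V
  let F : V × V → Finset V := fun p => univ.filter fun w => Bd p.1 w p.2
  -- Two averaging steps: `Q` holds the pairs with more than `t` bad middle vertices, and `Z` the
  -- vertices in more than `t` such pairs.
  let Q : Finset (V × V) := univ.filter fun p => t < #(F p)
  have h1 : ∑ p : V × V, (#(F p) : ℝ) ≤ n * (n * D) := by
    have e1 : ∀ p : V × V, (#(F p) : ℝ) = ∑ w : V, if Bd p.1 w p.2 then 1 else 0 := by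
      intro p; simp [F]
    simp_rw [e1]
    rw [Fintype.sum_prod_type]
    have e2 : ∀ x : V, ∑ y : V, ∑ w : V, (if Bd x w y then (1 : ℝ) else 0) ≤ n * D := by
      intro x
      rw [sum_comm]
      refine (sum_le_sum (g := fun _ => D) fun w _ => ?_).trans_eq (by simp [n])
      have := hD x w (univ.filter fun y => Bd x w y) (by simp)
      simpa using this
    exact (sum_le_sum fun x _ => e2 x).trans_eq (by simp [n])
  have h2 : (#Q : ℝ) * t ≤ n * (n * D) := by
    have := card_nsmul_le_sum Q (fun p => (#(F p) : ℝ)) t fun p hp => (mem_filter.1 hp).2.le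
    rw [nsmul_eq_mul] at this
    exact this.trans ((sum_le_sum_of_subset_of_nonneg (subset_univ _)
      fun _ _ _ => by positivity).trans h1)
  let G : V → Finset V := fun x => univ.filter fun y => (x, y) ∈ Q ∨ (y, x) ∈ Q
  let Z : Finset V := univ.filter fun x => t < #(G x)
  have h3 : ∑ x : V, (#(G x) : ℝ) ≤ 2 * #Q := by
    have e1 : ∀ x, (#(G x) : ℝ) ≤ #(univ.filter fun y => (x, y) ∈ Q) +
        #(univ.filter fun y => (y, x) ∈ Q) := by
      intro x
      have : #(G x) ≤ #(univ.filter fun y => (x, y) ∈ Q) + #(univ.filter fun y => (y, x) ∈ Q) := by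
        simp only [G]
        rw [filter_or]
        exact card_union_le _ _
      exact_mod_cast this
    have e2 : ∑ x : V, (#(univ.filter fun y => (x, y) ∈ Q) : ℝ) = #Q := by
      have : (#Q : ℝ) = ∑ p : V × V, if p ∈ Q then 1 else 0 := by simp
      rw [this, Fintype.sum_prod_type]
      simp
    have e3 : ∑ x : V, (#(univ.filter fun y => (y, x) ∈ Q) : ℝ) = #Q := by
      have : (#Q : ℝ) = ∑ p : V × V, if p ∈ Q then 1 else 0 := by simp
      rw [this, Fintype.sum_prod_type_right]
      simp
    refine (sum_le_sum fun x _ => e1 x).trans_eq ?_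
    rw [sum_add_distrib, e2, e3]
    ring
  have h4 : (#Z : ℝ) * t ≤ 2 * #Q := by
    have := card_nsmul_le_sum Z (fun p => (#(G p) : ℝ)) t fun p hp => (mem_filter.1 hp).2.le
    rw [nsmul_eq_mul] at this
    exact this.trans ((sum_le_sum_of_subset_of_nonneg (subset_univ _)
      fun _ _ _ => by positivity).trans h3)
  refine ⟨Z, fun x y => (x, y) ∉ Q ∧ (y, x) ∉ Q, ?_, fun x y h => ⟨h.2, h.1⟩, ?_, ?_⟩
  · calc (#Z : ℝ) * t ^ 2 = #Z * t * t := by ring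
      _ ≤ 2 * #Q * t := by gcongr
      _ = 2 * (#Q * t) := by ring
      _ ≤ 2 * (n * (n * D)) := by gcongr
      _ = _ := by ring
  · intro x hx N hN
    have : ¬ t < #(G x) := fun h => hx (mem_filter.2 ⟨mem_univ _, h⟩)
    refine le_trans (Nat.cast_le.2 (card_le_card fun y hy => ?_)) (not_lt.1 this)
    have := hN y hy
    exact mem_filter.2 ⟨mem_univ _, by tauto⟩
  · intro x y hxy N hN
    have : ¬ t < #(F (x, y)) := fun h => hxy.1 (mem_filter.2 ⟨mem_univ _, h⟩)
    refine le_trans (Nat.cast_le.2 (card_le_card fun y hy => ?_)) (not_lt.1 this)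
    exact mem_filter.2 ⟨mem_univ _, hN y hy⟩

/-- The ratio of the binomials is at most `a / n`, since `j * a.choose j = a * (a - 1).choose (j -
1)`. It turns a degree bound into a bound on the number of extending vertices. -/
theorem choose_mul_le_mul_choose {a n j : ℕ} (han : a ≤ n) (hj : j ≠ 0) :
    a.choose j * n ≤ a * n.choose j := by
  obtain ⟨j, rfl⟩ := Nat.exists_eq_succ_of_ne_zero hj
  rcases a with _ | a
  · simp
  rcases n with _ | n
  · omega
  have h1 := Nat.add_one_mul_choose_eq a j
  have h2 := Nat.add_one_mul_choose_eq n j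
  have h3 : a.choose j ≤ n.choose j := Nat.choose_le_choose j (by omega)
  refine Nat.le_of_mul_le_mul_right (c := j + 1) ?_ (by omega)
  calc (a + 1).choose (j + 1) * (n + 1) * (j + 1)
      = ((a + 1).choose (j + 1) * (j + 1)) * (n + 1) := by ring
    _ = (a + 1) * a.choose j * (n + 1) := by rw [← h1]
    _ ≤ (a + 1) * n.choose j * (n + 1) := by gcongr
    _ = (a + 1) * ((n + 1) * n.choose j) := by ring
    _ = _ := by rw [h2]; ring

theorem sq_le_two_mul_two_pow (n : ℕ) : n ^ 2 ≤ 2 * 2 ^ n := by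
  induction n with
  | zero => norm_num
  | succ n ih =>
    have : n + 1 ≤ 2 ^ n := Nat.lt_two_pow_self
    rw [pow_succ 2 n]
    nlinarith

/-! ### From dense `4`-graphs to clique systems -/

namespace KGraph

/-- `S` is contained in an edge. -/
def Active {V : Type*} {k : ℕ} (H : KGraph V k) (S : Finset V) : Prop := ∃ f ∈ H.edges, S ⊆ f

theorem Active.mem_edges {V : Type*} {k : ℕ} {H : KGraph V k} {S : Finset V} (h : H.Active S) (hS : #S = k) :
    S ∈ H.edges := by
  obtain ⟨f, hf, hSf⟩ := h
  rwa [eq_of_subset_of_card_le hSf (by rw [H.uniform f hf, hS])]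

section
variable {V : Type*} [DecidableEq V]

/-- The edges that can be reached from `e` by tight walks. -/
def reach {k : ℕ} (H : KGraph V k) (e : Finset V) : Set (Finset V) :=
  {f | Relation.ReflTransGen H.TightAdj e f}

/-- Distinct edges with a common triple are tightly adjacent, so a triple determines the component
of the edges of one colour class above it. -/
theorem reach_eq {H : KGraph V 4} {e f T : Finset V} (he : e ∈ H.edges) (hf : f ∈ H.edges)
    (hT : 3 ≤ #T) (hTe : T ⊆ e) (hTf : T ⊆ f) : H.reach e = H.reach f := by
  by_cases hef : e = f
  · rw [hef]
  have h1 : #(e ∩ f) = 3 := by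
    have e1 : 3 ≤ #(e ∩ f) := hT.trans (card_le_card (subset_inter hTe hTf))
    have e2 : #(e ∩ f) ≠ 4 := by
      intro h
      have e3 : e ∩ f = e := eq_of_subset_of_card_le inter_subset_left (by rw [h, H.uniform e he])
      have e4 : e ∩ f = f := eq_of_subset_of_card_le inter_subset_right (by rw [h, H.uniform f hf])
      exact hef (e3.symm.trans e4)
    have e5 : #(e ∩ f) ≤ 4 := (card_le_card inter_subset_left).trans_eq (H.uniform e he)
    omega
  have hef : H.TightAdj e f := ⟨he, hf, h1⟩
  have hfe : H.TightAdj f e := ⟨hf, he, by rwa [inter_comm]⟩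
  ext g
  exact ⟨fun h => Relation.ReflTransGen.head hfe h, fun h => Relation.ReflTransGen.head hef h⟩

theorem degree_ne_zero [Fintype V] {k : ℕ} {H : KGraph V k} {S : Finset V} (h : H.Active S) :
    H.degree S ≠ 0 := by
  obtain ⟨f, hf, hSf⟩ := h
  refine (card_pos.2 ⟨f \ S, ?_⟩).ne'
  rw [nbhd, mem_filter, mem_powersetCard, sdiff_union_of_subset hSf]
  exact ⟨⟨subset_univ _, by rw [card_sdiff_of_subset hSf, H.uniform f hf]⟩, hf⟩

/-- A set inside an edge has positive degree, hence is not exceptional. Its link lives on the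
vertices that keep it active, and a near-complete link needs at least `(1 - ε) * n` of them, `n`
being the number of vertices. -/
theorem card_not_active_insert_le [Fintype V] {H : KGraph V 4} {ε α : ℝ}
    (hH : H.IsDense (1 - ε) α) {S : Finset V} (hS : H.Active S) (h1 : 1 ≤ #S) (h3 : #S ≤ 3)
    (N : Finset V) (hN : ∀ w ∈ N, ¬ H.Active (insert w S)) :
    (#N : ℝ) ≤ ε * Fintype.card V := by
  classical
  set n := Fintype.card V
  obtain ⟨X, -, -, hX, hX0⟩ := hH #S h1 h3
  have hdeg := hX S (mem_powersetCard.2 ⟨subset_univ _, rfl⟩)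
    fun h => degree_ne_zero hS (hX0 S h)
  let A : Finset V := univ.filter fun w => H.Active (insert w S)
  have hsub : H.nbhd S ⊆ powersetCard (4 - #S) A := by
    intro T hT
    rw [nbhd, mem_filter, mem_powersetCard] at hT
    refine mem_powersetCard.2 ⟨fun w hw => ?_, hT.1.2⟩
    exact mem_filter.2 ⟨mem_univ _, _, hT.2, insert_subset (mem_union_left _ hw) subset_union_right⟩
  have hd : H.degree S ≤ (#A).choose (4 - #S) := by
    rw [← card_powersetCard]
    exact card_le_card hsub
  have hAn : #A ≤ n := card_le_univ _
  have hc := choose_mul_le_mul_choose hAn (by omega : 4 - #S ≠ 0)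
  obtain ⟨f, hf, -⟩ := hS
  have hn4 : 4 ≤ n := (H.uniform f hf).symm.le.trans (card_le_univ f)
  have hpos : (0 : ℝ) < n.choose (4 - #S) := by
    exact_mod_cast Nat.choose_pos (by omega)
  have h5 : (1 - ε) * n * (n.choose (4 - #S)) ≤ #A * n.choose (4 - #S) := by
    have e1 : (H.degree S : ℝ) ≤ (#A).choose (4 - #S) := by exact_mod_cast hd
    have e2 : ((#A).choose (4 - #S) : ℝ) * n ≤ #A * n.choose (4 - #S) := by exact_mod_cast hc
    have e3 : (1 - ε) * (n.choose (4 - #S)) * n ≤ ((#A).choose (4 - #S) : ℝ) * n := by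
      gcongr
      exact hdeg.trans e1
    linarith
  have h6 : (1 - ε) * n ≤ #A := le_of_mul_le_mul_right h5 hpos
  have h7 : #N + #A ≤ n := by
    rw [← card_union_of_disjoint]
    · exact card_le_univ _
    · exact Finset.disjoint_left.2 fun w hw hwA => hN w hw (mem_filter.1 hwA).2
  have h8 : (#N : ℝ) + #A ≤ n := by exact_mod_cast h7
  linarith

/-- For `ε < 1` the degree threshold is positive, so an inactive vertex must be an exceptional
singleton. -/
theorem card_not_active_singleton_le [Fintype V] {H : KGraph V 4} {ε α : ℝ}
    (hH : H.IsDense (1 - ε) α) (hε : ε < 1) (hn : 3 ≤ Fintype.card V) (N : Finset V)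
    (hN : ∀ w ∈ N, ¬ H.Active {w}) : (#N : ℝ) ≤ α * Fintype.card V := by
  obtain ⟨X, -, hXc, hX, -⟩ := hH 1 le_rfl (by norm_num)
  rw [Nat.choose_one_right] at hXc
  refine le_trans (Nat.cast_le.2 ?_) hXc
  refine card_le_card_of_injOn singleton (fun w hw => ?_) (singleton_injective.injOn)
  by_contra hwX
  have h1 := hX {w} (mem_powersetCard.2 ⟨subset_univ _, card_singleton _⟩) hwX
  have h2 : (0 : ℝ) < (Fintype.card V).choose (4 - 1) := by exact_mod_cast Nat.choose_pos hn
  have h3 : (0 : ℝ) < H.degree {w} := lt_of_lt_of_le (mul_pos (by linarith) h2) h1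
  have h4 : 0 < #(H.nbhd {w}) := by exact_mod_cast h3
  obtain ⟨T, hT⟩ := card_pos.1 h4
  exact hN w hw ⟨_, (mem_filter.1 hT).2, subset_union_right⟩

/-- The set `insert z p` is contained in an edge of colour `i` whose tight component is `K`. -/
def InShadow {k : ℕ} (H : KGraph V k) (c : Finset V → EdgeColour) (i : EdgeColour)
    (K : Set (Finset V)) (p : Finset V) (z : V) : Prop :=
  ∃ f ∈ (H.colourClass c i).edges, insert z p ⊆ f ∧ (H.colourClass c i).reach f = K

/-- The link of a pair has a spanning monochromatic component. -/
theorem exists_inShadow [Fintype V] {H : KGraph V 4} {ε α : ℝ} (hH : H.IsDense (1 - ε) α)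
    (c : Finset V → EdgeColour) {p : Finset V} (hp : H.Active p) (hp2 : #p = 2) :
    ∃ (i : EdgeColour) (K : Set (Finset V)), ∀ N : Finset V,
      (∀ z ∈ N, ¬ H.InShadow c i K p z) → (#N : ℝ) ≤ 3 * (ε * Fintype.card V) + 2 := by
  classical
  set d := ε * Fintype.card V with hd
  -- A partial equivalence on the link of `p`: the triples above `z` and `w` see the same component
  -- of colour `i`. If `p ∪ {z, w}` is an edge, its colour relates `z` to `w`, so few points are
  -- unrelated in both colours.
  let r : EdgeColour → V → V → Prop := fun i z w => z ∉ p ∧ w ∉ p ∧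
    ∃ f ∈ (H.colourClass c i).edges, ∃ g ∈ (H.colourClass c i).edges,
      insert z p ⊆ f ∧ insert w p ⊆ g ∧ (H.colourClass c i).reach f = (H.colourClass c i).reach g
  have hsymm : ∀ i {x y}, r i x y → r i y x := by
    rintro i x y ⟨hx, hy, f, hf, g, hg, h1, h2, h3⟩
    exact ⟨hy, hx, g, hg, f, hf, h2, h1, h3.symm⟩
  have htrans : ∀ i {x y z}, r i x y → r i y z → r i x z := by
    rintro i x y z ⟨hx, hy, f, hf, g, hg, h1, h2, h3⟩ ⟨-, hz, f', hf', g', hg', h1', h2', h3'⟩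
    refine ⟨hx, hz, f, hf, g', hg', h1, h2', h3.trans (Eq.trans ?_ h3')⟩
    exact reach_eq hg hf' (by rw [card_insert_of_notMem hy, hp2]) h2 h1'
  let A : Finset V := univ.filter fun z => z ∉ p ∧ H.Active (insert z p)
  have hAd : ∀ z ∈ A, ∀ N ⊆ A, (∀ w ∈ N, ¬ r .red z w ∧ ¬ r .blue z w) → (#N : ℝ) ≤ d := by
    intro z hz N hNA hN
    obtain ⟨-, hzp, hza⟩ := mem_filter.1 hz
    have hz3 : #(insert z p) = 3 := by rw [card_insert_of_notMem hzp, hp2]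
    refine card_not_active_insert_le hH hza (by omega) (by omega) _ fun w hw hact => ?_
    obtain ⟨hwr, hwb⟩ := hN w hw
    obtain ⟨-, hwp, -⟩ := mem_filter.1 (hNA hw)
    obtain ⟨f, hf, hff⟩ := hact
    have key : r (c f) z w := by
      have hfc : f ∈ (H.colourClass c (c f)).edges := mem_filter.2 ⟨hf, rfl⟩
      refine ⟨hzp, hwp, f, hfc, f, hfc, (subset_insert _ _).trans hff, ?_, rfl⟩
      exact (insert_subset_insert _ (subset_insert _ _)).trans hff
    cases hcf : c f
    · rw [hcf] at key; exact hwr key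
    · rw [hcf] at key; exact hwb key
  obtain ⟨z, hz⟩ : A.Nonempty := by
    obtain ⟨f, hf, hpf⟩ := hp
    obtain ⟨z, hz⟩ : (f \ p).Nonempty := by
      rw [← card_pos, card_sdiff_of_subset hpf, H.uniform f hf, hp2]
      norm_num
    rw [Finset.mem_sdiff] at hz
    exact ⟨z, mem_filter.2 ⟨mem_univ _, hz.2, f, hf, insert_subset hz.1 hpf⟩⟩
  have hd0 : 0 ≤ d := (Nat.cast_nonneg _).trans (hAd z hz ∅ (empty_subset _) (by simp))
  obtain ⟨i, hi⟩ : ∃ i, ∀ N ⊆ A, (∀ w ∈ N, ¬ r i z w) → (#N : ℝ) ≤ 2 * d := by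
    rcases card_not_le_or_card_not_le (r := r .red) (b := r .blue) (htrans .red) (hsymm .blue) (htrans .blue) hAd hz
      with h | h
    · exact ⟨_, h⟩
    · exact ⟨.blue, fun N h1 h2 => (h N h1 h2).trans (by linarith)⟩
  obtain ⟨K, hK⟩ : ∃ K, ∀ w, r i z w → H.InShadow c i K p w := by
    by_cases hex : ∃ f ∈ (H.colourClass c i).edges, insert z p ⊆ f
    · obtain ⟨f, hf, hzf⟩ := hex
      refine ⟨(H.colourClass c i).reach f, ?_⟩
      rintro w ⟨hzp, hwp, f', hf', g, hg, h1, h2, h3⟩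
      refine ⟨g, hg, h2, h3.symm.trans ?_⟩
      exact reach_eq hf' hf (by rw [card_insert_of_notMem hzp, hp2]) h1 hzf
    · refine ⟨∅, ?_⟩
      rintro w ⟨hzp, hwp, f', hf', g, hg, h1, h2, h3⟩
      exact absurd ⟨f', hf', h1⟩ hex
  refine ⟨i, K, fun N hN => ?_⟩
  let N1 : Finset V := univ.filter fun z => ¬ H.Active (insert z p)
  have hN1 : (#N1 : ℝ) ≤ d := card_not_active_insert_le hH hp (by omega) (by omega) N1
    fun w hw => (mem_filter.1 hw).2
  have hsub : N ⊆ (N1 ∪ p) ∪ A.filter fun w => ¬ r i z w := by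
    intro w hw
    by_contra hcon
    rw [mem_union, mem_union, not_or, not_or] at hcon
    obtain ⟨⟨g1, g2⟩, g3⟩ := hcon
    refine hN w hw (hK w (by_contra fun hr => g3 (mem_filter.2 ⟨mem_filter.2 ⟨mem_univ _, g2, ?_⟩,
      hr⟩)))
    exact by_contra fun h => g1 (mem_filter.2 ⟨mem_univ _, h⟩)
  have hi := hi _ (filter_subset (fun w => ¬ r i z w) A) fun w hw => (mem_filter.1 hw).2
  have h1 := card_le_card hsub
  have h2 := card_union_le (N1 ∪ p) (A.filter fun w => ¬ r i z w)
  have h3 := card_union_le N1 p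
  have h4 : (#N : ℝ) ≤ #N1 + 2 + #(A.filter fun w => ¬ r i z w) := by
    exact_mod_cast (by omega : #N ≤ #N1 + 2 + #(A.filter fun w => ¬ r i z w))
  linarith

end

end KGraph

theorem EdgeColour.eq_of_red_iff {i j : EdgeColour} (h : i = .red ↔ j = .red) : i = j := by
  cases i <;> cases j <;> simp_all

namespace KGraph

section
variable {V : Type*} [DecidableEq V]

/-- The clique system given by a family of sets all of whose pairs and triples behave well. -/
def cliqueSystem (H : KGraph V 4) (c : Finset V → EdgeColour) (g : Finset V → EdgeColour)
    (K : Finset V → Set (Finset V)) (Z : Finset V) (P : V → V → Prop) :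
    CliqueSystem V (Set (Finset V)) where
  -- The last condition places each triple in the component chosen for each of its pairs. The
  -- conditions on `Z` and `P` are there so that this can be preserved when a vertex is added.
  IsClique A := (∀ S ⊆ A, S.Nonempty → #S ≤ 4 → H.Active S) ∧ (∀ x ∈ A, x ∉ Z) ∧
    (∀ x ∈ A, ∀ y ∈ A, x ≠ y → P x y) ∧
    ∀ x ∈ A, ∀ y ∈ A, ∀ z ∈ A, x ≠ y → x ≠ z → y ≠ z →
      H.InShadow c (g {x, y}) (K {x, y}) {x, y} z
  col X := c X = .red
  pcol p := g p = .red
  comp X := (H.colourClass c (c X)).reach X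
  pcomp := K
  mono hAB h := ⟨fun S hS => h.1 S (hS.trans hAB), fun x hx => h.2.1 x (hAB hx),
    fun x hx y hy => h.2.2.1 x (hAB hx) y (hAB hy),
    fun x hx y hy z hz => h.2.2.2 x (hAB hx) y (hAB hy) z (hAB hz)⟩
  comp_eq_pcomp := by
    intro X p hX hX4 hpX hp h
    have hc := EdgeColour.eq_of_red_iff h
    obtain ⟨x, y, hxy, rfl⟩ := card_eq_two.1 hp
    obtain ⟨z, hz⟩ : (X \ {x, y}).Nonempty := by
      rw [← card_pos, card_sdiff_of_subset hpX, hX4, hp]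
      norm_num
    rw [Finset.mem_sdiff] at hz
    have hz' := hz.2
    simp only [mem_insert, mem_singleton, not_or] at hz'
    obtain ⟨f, hf, hfz, hfK⟩ := hX.2.2.2 x (hpX (by simp)) y (hpX (by simp)) z hz.1 hxy
      (Ne.symm hz'.1) (Ne.symm hz'.2)
    have hXe : X ∈ H.edges :=
      (hX.1 X Subset.rfl (card_pos.1 (by omega)) hX4.le).mem_edges hX4
    rw [← hfK, ← hc]
    rw [← hc] at hf
    exact reach_eq (mem_filter.2 ⟨hXe, rfl⟩) hf (by rw [card_insert_of_notMem hz.2, hp])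
      (insert_subset hz.1 hpX) hfz
  comp_eq_comp := by
    intro X Y hX hY hX4 hY4 hXY h
    have hc := EdgeColour.eq_of_red_iff h
    have hXe : X ∈ H.edges :=
      (hX.1 X Subset.rfl (card_pos.1 (by omega)) hX4.le).mem_edges hX4
    have hYe : Y ∈ H.edges :=
      (hY.1 Y Subset.rfl (card_pos.1 (by omega)) hY4.le).mem_edges hY4
    rw [hc]
    exact reach_eq (mem_filter.2 ⟨hXe, hc⟩) (mem_filter.2 ⟨hYe, rfl⟩) hXY.ge inter_subset_left
      inter_subset_right
  pcomp_eq_pcomp := by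
    intro x y z hxy hxz hyz hcl h
    have hc := EdgeColour.eq_of_red_iff h
    obtain ⟨f, hf, hfz, hfK⟩ := hcl.2.2.2 x (by simp) y (by simp) z (by simp) hxy hxz hyz
    obtain ⟨f', hf', hfz', hfK'⟩ := hcl.2.2.2 x (by simp) z (by simp) y (by simp) hxz hxy hyz.symm
    rw [← hfK, ← hfK', hc]
    rw [hc] at hf
    refine reach_eq hf hf' (T := {x, y, z}) (card_eq_three.2 ⟨x, y, z, hxy, hxz, hyz, rfl⟩).ge ?_ ?_
    · rwa [Finset.insert_comm, pair_comm z y] at hfz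
    · rwa [Finset.insert_comm] at hfz'

/-- A dense `2`-edge-coloured `4`-graph contains a clique system with few exceptional extensions. -/
theorem exists_cliqueSystem [Fintype V] {H : KGraph V 4} {ε α : ℝ} (hH : H.IsDense (1 - ε) α)
    (c : Finset V → EdgeColour) (hε : 0 < ε) (hα : 0 < α) (hα1 : α ≤ 1) (hεα : 8 * ε ≤ α ^ 3)
    (hn : 2 ≤ ε * Fintype.card V) :
    ∃ S : CliqueSystem V (Set (Finset V)), S.Extends (8 * α * Fintype.card V) ∧
      (∀ X, S.IsClique X → #X = 4 → X ∈ H.edges) ∧ (∀ X, S.col X ↔ c X = .red) ∧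
      ∀ X, S.comp X = (H.colourClass c (c X)).reach X := by
  classical
  set n := Fintype.card V with hndef
  have hα3 : α ^ 3 ≤ α := by nlinarith [mul_nonneg hα.le (by nlinarith : 0 ≤ 1 - α ^ 2)]
  have hn0 : (0 : ℝ) < n := by
    by_contra! h
    nlinarith
  have hn3 : 3 ≤ n := by
    have : (3 : ℝ) ≤ n := by nlinarith
    exact_mod_cast this
  have hαn : 0 < α * n := by positivity
  have hεn : 4 * (ε * n) ≤ α * n := by nlinarith
  have hex : ∀ p : Finset V, ∃ (i : EdgeColour) (K : Set (Finset V)), H.Active p → #p = 2 →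
      ∀ N : Finset V, (∀ z ∈ N, ¬ H.InShadow c i K p z) → (#N : ℝ) ≤ 4 * (ε * n) := by
    intro p
    by_cases h : H.Active p ∧ #p = 2
    · obtain ⟨i, K, hK⟩ := exists_inShadow hH c h.1 h.2
      exact ⟨i, K, fun _ _ N hN => (hK N hN).trans (by linarith)⟩
    · exact ⟨.red, ∅, fun h1 h2 => absurd ⟨h1, h2⟩ h⟩
  choose g K hgK using hex
  -- When `w` joins a clique, the new pair `{x, w}` must see the old vertex `y`. The bound at hand
  -- counts bad `y` for fixed `x`, `w`, whereas bad `w` for fixed `x`, `y` are needed;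
  -- `exists_good_pairs` converts one into the other.
  let Bd : V → V → V → Prop := fun x w y => w ≠ x ∧ H.Active {x, w} ∧
    ¬ H.InShadow c (g {x, w}) (K {x, w}) {x, w} y
  obtain ⟨Z, P, hZ, hPs, hZP, hP⟩ := exists_good_pairs Bd (D := 4 * (ε * n)) (t := α * n) hαn (by
    intro x w N hN
    rcases N.eq_empty_or_nonempty with rfl | ⟨y, hy⟩
    · simp; positivity
    obtain ⟨h1, h2, -⟩ := hN y hy
    exact hgK _ h2 (card_pair h1.symm) N fun y hy => (hN y hy).2.2)
  have hZn : (#Z : ℝ) ≤ α * n := by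
    refine le_of_mul_le_mul_right (a := (α * n) ^ 2) (hZ.trans ?_) (by positivity)
    calc 2 * (4 * (ε * n)) * (n : ℝ) ^ 2 = 8 * ε * n ^ 3 := by ring
      _ ≤ α ^ 3 * n ^ 3 := by gcongr
      _ = _ := by ring
  refine ⟨H.cliqueSystem c g K Z P, ⟨?_, ?_⟩, ?_, fun X => Iff.rfl, fun X => rfl⟩
  · refine ⟨fun S hS hSn => ?_, by simp, by simp, by simp⟩
    rw [subset_empty.1 hS] at hSn
    simp at hSn
  · rintro A N ⟨hA1, hA2, hA3, hA4⟩ hN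
    let U1 : Finset V → Finset V := fun S => univ.filter fun w => ¬ H.Active (insert w S)
    let U3 : V → Finset V := fun x => univ.filter fun w => ¬ P x w
    let U4 : V × V → Finset V := fun p => univ.filter fun w => p.1 ≠ p.2 ∧
      ¬ H.InShadow c (g {p.1, p.2}) (K {p.1, p.2}) {p.1, p.2} w
    let U5 : V × V → Finset V := fun p => univ.filter fun w => p.1 ≠ p.2 ∧ Bd p.1 w p.2
    let A3 := A.powerset.filter fun S => #S ≤ 3
    -- A vertex fails to extend `A` through an inactive set, membership in `Z`, a bad pair, or a
    -- shadow failure over an old pair or over a new one.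
    have hsub : N ⊆ A3.biUnion U1 ∪ Z ∪ A.biUnion U3 ∪ (A ×ˢ A).biUnion U4 ∪
        (A ×ˢ A).biUnion U5 := by
      intro w hw
      by_contra hcon
      simp only [mem_union, not_or, mem_biUnion, not_exists, not_and] at hcon
      obtain ⟨⟨⟨⟨g1, g2⟩, g3⟩, g4⟩, g5⟩ := hcon
      have g1 : ∀ S ⊆ A, #S ≤ 3 → H.Active (insert w S) := fun S hS hS3 => by_contra fun h =>
        g1 S (mem_filter.2 ⟨mem_powerset.2 hS, hS3⟩) (mem_filter.2 ⟨mem_univ _, h⟩)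
      have g3 : ∀ x ∈ A, P x w := fun x hx => by_contra fun h =>
        g3 x hx (mem_filter.2 ⟨mem_univ _, h⟩)
      have g4 : ∀ x ∈ A, ∀ y ∈ A, x ≠ y → H.InShadow c (g {x, y}) (K {x, y}) {x, y} w :=
        fun x hx y hy hxy => by_contra fun h =>
          g4 (x, y) (mem_product.2 ⟨hx, hy⟩) (mem_filter.2 ⟨mem_univ _, hxy, h⟩)
      have g5 : ∀ x ∈ A, ∀ y ∈ A, x ≠ y → w ≠ x →
          H.InShadow c (g {x, w}) (K {x, w}) {x, w} y := by
        intro x hx y hy hxy hwx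
        refine by_contra fun h => g5 (x, y) (mem_product.2 ⟨hx, hy⟩)
          (mem_filter.2 ⟨mem_univ _, hxy, hwx, ?_, h⟩)
        rw [pair_comm]
        exact g1 {x} (by simpa using hx) (by simp)
      refine hN w hw ⟨?_, ?_, ?_, ?_⟩
      · intro S hS hSn hS4
        by_cases hwS : w ∈ S
        · rw [← insert_erase hwS]
          refine g1 _ ?_ ?_
          · exact (erase_subset_erase _ hS).trans (erase_insert_subset _ _)
          · rw [card_erase_of_mem hwS]; omega
        · exact hA1 S ((subset_insert_iff_of_notMem hwS).1 hS) hSn hS4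
      · intro x hx
        rcases mem_insert.1 hx with rfl | hx
        · exact g2
        · exact hA2 x hx
      · intro x hx y hy hxy
        rcases mem_insert.1 hx with rfl | hxA <;> rcases mem_insert.1 hy with rfl | hyA
        · exact absurd rfl hxy
        · exact hPs _ _ (g3 y hyA)
        · exact g3 x hxA
        · exact hA3 x hxA y hyA hxy
      · intro x hx y hy z hz hxy hxz hyz
        rcases mem_insert.1 hx with rfl | hxA
        · have hyA := (mem_insert.1 hy).resolve_left hxy.symm
          have hzA := (mem_insert.1 hz).resolve_left hxz.symm
          rw [pair_comm]
          exact g5 y hyA z hzA hyz hxy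
        · rcases mem_insert.1 hy with rfl | hyA
          · have hzA := (mem_insert.1 hz).resolve_left hyz.symm
            exact g5 x hxA z hzA hxz hxy.symm
          · rcases mem_insert.1 hz with rfl | hzA
            · exact g4 x hxA y hyA hxy
            · exact hA4 x hxA y hyA z hzA hxy hxz hyz
    have b1 : ∀ S ∈ A3, (#(U1 S) : ℝ) ≤ α * n := by
      intro S hS
      obtain ⟨hSA, hS3⟩ := mem_filter.1 hS
      rcases S.eq_empty_or_nonempty with rfl | hSn
      · refine card_not_active_singleton_le hH (by nlinarith) hn3 _ fun w hw => ?_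
        simpa [U1] using hw
      · refine (card_not_active_insert_le hH (hA1 S (mem_powerset.1 hSA) hSn (by omega))
          (card_pos.2 hSn) hS3 _ fun w hw => (mem_filter.1 hw).2).trans (by nlinarith)
    have b3 : ∀ x ∈ A, (#(U3 x) : ℝ) ≤ α * n := fun x hx =>
      hZP x (hA2 x hx) _ fun y hy => (mem_filter.1 hy).2
    have b4 : ∀ p ∈ A ×ˢ A, (#(U4 p) : ℝ) ≤ α * n := by
      rintro ⟨x, y⟩ hp
      obtain ⟨hx, hy⟩ := mem_product.1 hp
      by_cases hxy : x = y
      · have : U4 (x, y) = ∅ := by simp [U4, hxy]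
        rw [this]; simp; positivity
      · refine (hgK {x, y} (hA1 _ ?_ (by simp) (card_le_two.trans (by norm_num))) (card_pair hxy) _
          fun w hw => (mem_filter.1 hw).2.2).trans hεn
        exact insert_subset hx (singleton_subset_iff.2 hy)
    have b5 : ∀ p ∈ A ×ˢ A, (#(U5 p) : ℝ) ≤ α * n := by
      rintro ⟨x, y⟩ hp
      obtain ⟨hx, hy⟩ := mem_product.1 hp
      by_cases hxy : x = y
      · have : U5 (x, y) = ∅ := by simp [U5, hxy]
        rw [this]; simp; positivity
      · exact hP x y (hA3 x hx y hy hxy) _ fun w hw => (mem_filter.1 hw).2.2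
    have hbU : ∀ {ι : Type _} (s : Finset ι) (U : ι → Finset V), (∀ i ∈ s, (#(U i) : ℝ) ≤ α * n) →
        (#(s.biUnion U) : ℝ) ≤ #s * (α * n) := by
      intro ι s U hU
      calc (#(s.biUnion U) : ℝ) ≤ ∑ i ∈ s, (#(U i) : ℝ) := by exact_mod_cast card_biUnion_le
        _ ≤ ∑ i ∈ s, α * n := sum_le_sum hU
        _ = _ := by simp
    have e1 := hbU A3 U1 b1
    have e3 := hbU A U3 b3
    have e4 : (#((A ×ˢ A).biUnion U4) : ℝ) ≤ #(A ×ˢ A) * (α * n) := by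
      calc (#((A ×ˢ A).biUnion U4) : ℝ) ≤ ∑ i ∈ A ×ˢ A, (#(U4 i) : ℝ) := by
            exact_mod_cast card_biUnion_le
        _ ≤ ∑ i ∈ A ×ˢ A, α * n := sum_le_sum b4
        _ = _ := by simp
    have e5 : (#((A ×ˢ A).biUnion U5) : ℝ) ≤ #(A ×ˢ A) * (α * n) := by
      calc (#((A ×ˢ A).biUnion U5) : ℝ) ≤ ∑ i ∈ A ×ˢ A, (#(U5 i) : ℝ) := by
            exact_mod_cast card_biUnion_le
        _ ≤ ∑ i ∈ A ×ˢ A, α * n := sum_le_sum b5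
        _ = _ := by simp
    have hA3c : (#A3 : ℝ) ≤ 2 ^ #A := by
      have : #A3 ≤ 2 ^ #A := (card_filter_le _ _).trans_eq (card_powerset A)
      exact_mod_cast this
    have hAA : (#(A ×ˢ A) : ℝ) ≤ 2 * 2 ^ #A := by
      have := sq_le_two_mul_two_pow #A
      rw [card_product, ← sq]
      exact_mod_cast this
    have hAc : (#A : ℝ) + 1 ≤ 2 ^ #A := by exact_mod_cast Nat.lt_two_pow_self
    have hN : (#N : ℝ) ≤ #(A3.biUnion U1) + #Z + #(A.biUnion U3) + #((A ×ˢ A).biUnion U4) +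
        #((A ×ˢ A).biUnion U5) := by
      have := (card_le_card hsub).trans ((card_union_le _ _).trans (add_le_add_left
        ((card_union_le _ _).trans (add_le_add_left ((card_union_le _ _).trans
          (add_le_add_left (card_union_le _ _) _)) _)) _))
      exact_mod_cast this
    calc (#N : ℝ) ≤ 2 ^ #A * (α * n) + α * n + #A * (α * n) + 2 * 2 ^ #A * (α * n) +
          2 * 2 ^ #A * (α * n) := by
          have := mul_le_mul_of_nonneg_right hA3c hαn.le
          have := mul_le_mul_of_nonneg_right hAA hαn.le
          linarith
      -- The factor `5` is one family of subsets plus two families of ordered pairs, each of the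
      -- latter bounded by `2 * 2 ^ #A`.
      _ = (5 * 2 ^ #A + (#A + 1)) * (α * n) := by ring
      _ ≤ (8 * 2 ^ #A) * (α * n) := by
          gcongr
          have : (0 : ℝ) < 2 ^ #A := by positivity
          linarith
      _ = _ := by ring
  · intro X hX hX4
    exact (hX.1 X Subset.rfl (card_pos.1 (by omega)) hX4.le).mem_edges hX4

/-- Almost all vertices of a dense `2`-edge-coloured `4`-graph are covered by two disjoint tightly
connected matchings, one of each colour. -/
theorem exists_tightlyConnectedMatchings [Fintype V] {H : KGraph V 4} {ε α η : ℝ}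
    (hH : H.IsDense (1 - ε) α) (c : Finset V → EdgeColour) (hε : 0 < ε) (hα : 0 < α) (hα1 : α ≤ 1)
    (hη : 0 < η) (hη1 : η ≤ 1) (hεα : 8 * ε ≤ α ^ 3) (hαη : 2 ^ 22 * α ≤ η ^ 2)
    (hn : 2 ≤ ε * Fintype.card V) :
    ∃ MR MB : Finset (Finset V),
      (H.colourClass c .red).IsTightlyConnectedMatching MR ∧
      (H.colourClass c .blue).IsTightlyConnectedMatching MB ∧
      Disjoint (coveredVertices MR) (coveredVertices MB) ∧
      (((coveredVertices MR ∪ coveredVertices MB)ᶜ).card : ℝ) ≤ 3 * η * (Fintype.card V : ℝ) := by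
  classical
  obtain ⟨S, hS, hSe, hSc, hSl⟩ := exists_cliqueSystem hH c hε hα hα1 hεα hn
  set n := Fintype.card V
  have hα3 : α ^ 3 ≤ α := by nlinarith [mul_nonneg hα.le (by nlinarith : 0 ≤ 1 - α ^ 2)]
  have hn0 : (0 : ℝ) < n := by
    by_contra! h
    nlinarith
  have hη2 : η ^ 2 ≤ η := by nlinarith
  have h1 : 8 * (ε * n) ≤ α * n := by
    have : 8 * ε * n ≤ α * n := by
      gcongr
      linarith
    linarith
  have h2 : 2 ^ 22 * α * n ≤ η ^ 2 * n := by gcongr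
  have h3 : η ^ 2 * n ≤ η * n := by gcongr
  have h4 : 2 ^ 22 * α * n * n ≤ η ^ 2 * n * n := by gcongr
  have h5 : 0 ≤ η ^ 2 * n * n := by positivity
  have h6 : 0 ≤ η * n := by positivity
  -- With `b = 8 * α * n` the requirements become `2 ^ 21 * α * n ≤ 3 * η * n` and `2 ^ 22 * α * n ^
  -- 2 ≤ 9 * η ^ 2 * n ^ 2`.
  obtain ⟨M, R, B, hMd, hM, hMc⟩ := S.hasCover hS (m := 3 * η * n) (by linarith) (by linarith) (by
    nlinarith)
  have hred : ∀ e ∈ M, c e = .red → S.RedEdge R e := fun e he hc =>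
    (hM e he).resolve_right fun h => h.2.2.1 ((hSc e).2 hc)
  have hblue : ∀ e ∈ M, c e = .blue → S.BlueEdge B e := fun e he hc =>
    (hM e he).resolve_left fun h => by
      have := (hSc e).1 h.2.2.1
      rw [hc] at this
      cases this
  have hconn : ∀ (i : EdgeColour) (L : Set (Finset V)),
      (∀ e ∈ M, c e = i → #e = 4 ∧ S.IsClique e ∧ S.comp e = L) →
      (H.colourClass c i).IsTightlyConnectedMatching (M.filter fun e => c e = i) := by
    intro i L hL
    have hsub : (M.filter fun e => c e = i) ⊆ (H.colourClass c i).edges := by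
      intro e he
      obtain ⟨he, hc⟩ := mem_filter.1 he
      obtain ⟨h4, hcl, -⟩ := hL e he hc
      exact mem_filter.2 ⟨hSe e hcl h4, hc⟩
    refine ⟨⟨hsub, fun e he f hf hef => ?_⟩, hsub, fun e he f hf => ?_⟩
    · exact hMd (mem_filter.1 he).1 (mem_filter.1 hf).1 hef
    · obtain ⟨he, hce⟩ := mem_filter.1 he
      obtain ⟨hf, hcf⟩ := mem_filter.1 hf
      have h1 := (hL e he hce).2.2
      have h2 := (hL f hf hcf).2.2
      rw [hSl, hce] at h1
      rw [hSl, hcf] at h2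
      have : f ∈ (H.colourClass c i).reach e := by
        rw [h1, ← h2]
        exact Relation.ReflTransGen.refl
      exact this
  refine ⟨M.filter fun e => c e = .red, M.filter fun e => c e = .blue, hconn _ R fun e he hc =>
    ⟨(hred e he hc).1, (hred e he hc).2.1, (hred e he hc).2.2.2⟩, hconn _ B fun e he hc =>
    ⟨(hblue e he hc).1, (hblue e he hc).2.1, (hblue e he hc).2.2.2⟩, ?_, ?_⟩
  · refine Finset.disjoint_left.2 fun x hx hx' => ?_
    obtain ⟨e, he, hxe⟩ := mem_biUnion.1 hx
    obtain ⟨f, hf, hxf⟩ := mem_biUnion.1 hx'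
    obtain ⟨he, hce⟩ := mem_filter.1 he
    obtain ⟨hf, hcf⟩ := mem_filter.1 hf
    refine Finset.disjoint_left.1 (hMd he hf ?_) hxe hxf
    rintro rfl
    rw [hce] at hcf
    cases hcf
  · have : coveredVertices (M.filter fun e => c e = .red) ∪
        coveredVertices (M.filter fun e => c e = .blue) = coveredVertices M := by
      rw [coveredVertices, coveredVertices, ← union_biUnion, ← filter_or]
      congr 1
      refine filter_true_of_mem fun e _ => ?_
      cases c e <;> simp
    rw [this]
    exact hMc

end

end KGraph

/-! ### Fractional matchings and the bound on `muStar` -/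

theorem KGraph.IsDense.mono {V : Type*} [Fintype V] [DecidableEq V] {k : ℕ} {H : KGraph V k}
    {μ ν α β : ℝ} (h : H.IsDense μ α) (hμ : ν ≤ μ) (hα : α ≤ β) : H.IsDense ν β := by
  intro i h1 h2
  obtain ⟨X, hX, hXc, hXd, hX0⟩ := h i h1 h2
  refine ⟨X, hX, hXc.trans (by gcongr), fun S hS hSX => le_trans ?_ (hXd S hS hSX), hX0⟩
  gcongr

theorem KGraph.IsTightlyConnected.exists_isTightComponent {V : Type*} [Fintype V] [DecidableEq V]
    {k : ℕ} {H : KGraph V k} {F : Finset (Finset V)} (hF : H.IsTightlyConnected F) :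
    ∃ C, F ⊆ C ∧ H.IsTightComponent C := by
  obtain ⟨C, hFC, hC⟩ := (Set.toFinite {C | H.IsTightlyConnected C}).exists_le_maximal hF
  exact ⟨C, hFC, hC⟩

/-- The indicator function of a matching is a fractional matching. -/
theorem KGraph.isFractionalMatching_indicator {V : Type*} [DecidableEq V] {k : ℕ}
    {H : KGraph V k} {M : Finset (Finset V)} (hM : H.IsMatching M) :
    H.IsFractionalMatching (fun e => if e ∈ M then 1 else 0) := by
  refine ⟨fun e _ => ?_, fun v => ?_⟩
  · dsimp only
    split_ifs <;> norm_num
  · rw [sum_ite_mem, sum_const, nsmul_eq_mul, mul_one]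
    norm_cast
    rw [card_le_one]
    intro e he f hf
    simp only [mem_inter, mem_filter] at he hf
    by_contra hef
    exact Finset.disjoint_left.1 (hM.2 e he.2 f hf.2 hef) he.1.2 hf.1.2

/-- The two matchings together have at least `(1 - 3 * η) * n / 4` edges, and integrality allows any
`m` below that bound plus one. Since the weight must equal `m` exactly, surplus edges are discarded.
-/
theorem isForcedWeight_of_le {n : ℕ} {ε α η δ : ℝ} (hε : 0 < ε) (hα : 0 < α) (hα1 : α ≤ 1)
    (hη : 0 < η) (hη1 : η ≤ 1) (hεα : 8 * ε ≤ α ^ 3) (hαη : 2 ^ 22 * α ≤ η ^ 2)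
    (hn : 2 ≤ ε * n) (hδ : δ ≤ ε) (hδ' : δ ≤ α) {m : ℕ} (hm : m < (1 - 3 * η) * n / 4 + 1) :
    IsForcedWeight 4 1 δ n m := by
  intro H c hH
  have hH' : H.IsDense (1 - ε) α := hH.mono (by linarith) hδ'
  obtain ⟨MR, MB, hR, hB, hdis, hcov⟩ := KGraph.exists_tightlyConnectedMatchings hH' c hε hα hα1 hη
    hη1 hεα hαη (by rwa [Fintype.card_fin])
  rw [Fintype.card_fin] at hcov
  have hRe : ∀ e ∈ MR, e ∈ H.edges ∧ c e = .red := fun e he => mem_filter.1 (hR.1.1 he)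
  have hBe : ∀ e ∈ MB, e ∈ H.edges ∧ c e = .blue := fun e he => mem_filter.1 (hB.1.1 he)
  have hM : H.IsMatching (MR ∪ MB) := by
    refine ⟨fun e he => ?_, fun e he f hf hef => ?_⟩
    · rcases mem_union.1 he with h | h
      · exact (hRe e h).1
      · exact (hBe e h).1
    · have hd : ∀ e ∈ MR, ∀ f ∈ MB, Disjoint e f := fun e he f hf =>
        hdis.mono (subset_biUnion_of_mem id he) (subset_biUnion_of_mem id hf)
      rcases mem_union.1 he with h | h <;> rcases mem_union.1 hf with h' | h'
      · exact hR.1.2 e h f h' hef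
      · exact hd e h f h'
      · exact (hd f h' e h).symm
      · exact hB.1.2 e h f h' hef
  have hcard : m ≤ #(MR ∪ MB) := by
    have h1 : #(coveredVertices (MR ∪ MB)) = #(MR ∪ MB) * 4 :=
      card_coveredVertices (fun e he f hf hef => hM.2 e he f hf hef)
        fun e he => H.uniform e (hM.1 he)
    have h2 : coveredVertices (MR ∪ MB) = coveredVertices MR ∪ coveredVertices MB := by
      rw [coveredVertices, union_biUnion]; rfl
    rw [h2] at h1
    have h3 : #(coveredVertices MR ∪ coveredVertices MB)ᶜ + #(MR ∪ MB) * 4 = n := by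
      rw [← h1, card_compl_add_card, Fintype.card_fin]
    have h4 : (#(coveredVertices MR ∪ coveredVertices MB)ᶜ : ℝ) + #(MR ∪ MB) * 4 = n := by
      exact_mod_cast h3
    have h5 : (m : ℝ) < #(MR ∪ MB) + 1 := by linarith
    have h6 : m < #(MR ∪ MB) + 1 := by exact_mod_cast h5
    omega
  obtain ⟨M, hMsub, hMm⟩ := exists_subset_card_eq hcard
  obtain ⟨CR, hCR, hCR'⟩ := hR.2.exists_isTightComponent
  obtain ⟨CB, hCB, hCB'⟩ := hB.2.exists_isTightComponent
  have hMM : H.IsMatching M := ⟨hMsub.trans hM.1, fun e he f hf => hM.2 e (hMsub he) f (hMsub hf)⟩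
  have hmem : ∀ e, (if e ∈ M then (1 : ℝ) else 0) ≠ 0 → e ∈ M := fun e h => by
    by_contra h'
    simp [h'] at h
  refine ⟨fun e => if e ∈ M then 1 else 0, KGraph.isFractionalMatching_indicator hMM, ?_,
    fun e _ h => ?_, CR, CB, hCR', hCB', fun e _ h => ?_⟩
  · rw [KGraph.weight, sum_ite_mem, inter_eq_right.2 hMM.1]
    simp [hMm]
  · simp [hmem e h]
  · rcases mem_union.1 (hMsub (hmem e h)) with h | h
    · exact Or.inl (hCR h)
    · exact Or.inr (hCB h)

/-- Once `α` and `ε` are fixed from `η`, every smaller density parameter `δ` is handled by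
monotonicity, so one threshold `2 / ε` on `n` serves all `δ`. Rounding up keeps the forced weight
integral without loss. -/
theorem le_muStar_four_one {η : ℝ} (hη : 0 < η) (hη1 : η < 1 / 3) :
    (((1 - 3 * η) / 4 : ℝ) : EReal) ≤ muStar 4 1 := by
  obtain ⟨α, hα, hα1, hαη⟩ : ∃ α : ℝ, 0 < α ∧ α ≤ 1 ∧ 2 ^ 22 * α ≤ η ^ 2 :=
    ⟨η ^ 2 / 2 ^ 22, by positivity, by nlinarith, by linarith⟩
  obtain ⟨ε, hε, hεα⟩ : ∃ ε : ℝ, 0 < ε ∧ 8 * ε ≤ α ^ 3 := ⟨α ^ 3 / 8, by positivity, by linarith⟩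
  have hpos : 0 < min ε α := lt_min hε hα
  refine le_liminf_of_le (by isBoundedDefault) ?_
  filter_upwards [Ioo_mem_nhdsGT hpos] with δ hδ
  refine le_liminf_of_le (by isBoundedDefault) ?_
  filter_upwards [eventually_ge_atTop ⌈2 / ε⌉₊, eventually_gt_atTop 0] with n hn hn0
  have hn' : 2 ≤ ε * n := by
    have := Nat.ceil_le.1 hn
    rw [div_le_iff₀ hε] at this
    linarith
  have hnR : (0 : ℝ) < n := by exact_mod_cast hn0
  have hx : 0 ≤ (1 - 3 * η) * n / 4 := by
    have : 0 ≤ 1 - 3 * η := by linarith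
    positivity
  have hF := isForcedWeight_of_le hε hα hα1 hη (by linarith) hεα hαη hn'
    (hδ.2.le.trans (min_le_left _ _)) (hδ.2.le.trans (min_le_right _ _)) (Nat.ceil_lt_add_one hx)
  have h1 : (((⌈(1 - 3 * η) * n / 4⌉₊ : ℝ)) : EReal) ≤ muStarFinite 4 1 δ n :=
    le_sSup ⟨_, hF, rfl⟩
  have h2 : (((1 - 3 * η) * n / 4 : ℝ) : EReal) ≤ muStarFinite 4 1 δ n :=
    (EReal.coe_le_coe_iff.2 (Nat.le_ceil _)).trans h1
  have h3 : (((1 - 3 * η) / 4 : ℝ) : EReal) = (((1 - 3 * η) * n / 4 : ℝ) : EReal) / ((n : ℝ) : EReal) := by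
    rw [← EReal.coe_div]
    congr 1
    field_simp
  rw [h3]
  exact EReal.div_le_div_right_of_nonneg (by exact_mod_cast hnR.le) h2

theorem lemma6p1 :
    (∃ f g h : ℝ → ℝ, IsHierarchyFunction f ∧ IsHierarchyFunction g ∧ IsHierarchyFunction h ∧
      ∀ (n : ℕ) (ε α η : ℝ), 0 < n → ε ∈ Set.Ioc (0 : ℝ) 1 → α ∈ Set.Ioc (0 : ℝ) 1 →
        η ∈ Set.Ioo (0 : ℝ) 1 → 1 / (n : ℝ) ≤ f ε → ε ≤ g α → α ≤ h η →
        ∀ (V : Type*) [Fintype V] [DecidableEq V], Fintype.card V = n →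
          ∀ (H : KGraph V 4) (c : Finset V → EdgeColour), H.IsDense (1 - ε) α →
            ∃ MR MB : Finset (Finset V),
              (H.colourClass c .red).IsTightlyConnectedMatching MR ∧
              (H.colourClass c .blue).IsTightlyConnectedMatching MB ∧
              Disjoint (coveredVertices MR) (coveredVertices MB) ∧
              (((coveredVertices MR ∪ coveredVertices MB)ᶜ).card : ℝ) ≤ 3 * η * (n : ℝ)) ∧
    ((1 / 4 : ℝ) : EReal) ≤ muStar 4 1 := by
  constructor
  · refine ⟨fun x => x / 2, fun x => x ^ 3 / 8, fun x => x ^ 2 / 2 ^ 22, ⟨?_, ?_⟩, ⟨?_, ?_⟩,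
      ⟨?_, ?_⟩, ?_⟩
    · rintro x ⟨h0, h1⟩
      exact ⟨by positivity, by linarith⟩
    · rintro x - y - hxy
      dsimp only
      gcongr
    · rintro x ⟨h0, h1⟩
      have : x ^ 3 ≤ 1 := pow_le_one₀ h0.le h1
      exact ⟨by positivity, by linarith⟩
    · rintro x ⟨h0, -⟩ y - hxy
      dsimp only
      gcongr
    · rintro x ⟨h0, h1⟩
      have : x ^ 2 ≤ 1 := pow_le_one₀ h0.le h1
      exact ⟨by positivity, by linarith⟩
    · rintro x ⟨h0, -⟩ y - hxy
      dsimp only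
      gcongr
    · intro n ε α η hn hε hα hη h1 h2 h3 V _ _ hV H c hH
      subst hV
      have hnR : (0 : ℝ) < Fintype.card V := by exact_mod_cast hn
      have hn2 : 2 ≤ ε * Fintype.card V := by
        rw [div_le_iff₀ hnR] at h1
        linarith
      exact KGraph.exists_tightlyConnectedMatchings hH c hε.1 hα.1 hα.2 hη.1 hη.2.le
        (by linarith) (by linarith) hn2
  · refine le_of_forall_lt fun x hx => ?_
    have hlim : Tendsto (fun η : ℝ => (((1 - 3 * η) / 4 : ℝ) : EReal)) (𝓝[>] 0)
        (𝓝 ((1 / 4 : ℝ) : EReal)) := by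
      refine (continuous_coe_real_ereal.tendsto _).comp ?_
      have : Tendsto (fun η : ℝ => (1 - 3 * η) / 4) (𝓝 0) (𝓝 ((1 - 3 * 0) / 4)) :=
        (Continuous.tendsto (by fun_prop) 0)
      rw [mul_zero, sub_zero] at this
      exact this.mono_left nhdsWithin_le_nhds
    have hmem : ∀ᶠ η in 𝓝[>] (0 : ℝ), η ∈ Set.Ioo (0 : ℝ) (1 / 3) :=
      Ioo_mem_nhdsGT (by norm_num)
    obtain ⟨η, hη, hηx⟩ := (hmem.and (hlim.eventually_const_lt hx)).exists
    exact hηx.trans_le (le_muStar_four_one hη.1 hη.2)
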